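/- An \emph{operator space} is a norm-closed linear subspace $X$ of $\mathcal B(H)$ for a complex Hilbert space $H$; for $n\in\mathbb N$ the space $\mathrm M_n(X)$ of $n\times n$ matrices over $X$ carries the norm of $\mathcal B(H^{\oplus n})=\mathrm M_n(\mathcal B(H))\supseteq \mathrm M_n(X)$, and $B_Z$ denotes the closed unit ball of $Z$. For a map $f$ defined on a subset of $X$, write $f_n([x_{ij}])=[f(x_{ij})]$. A linear map $u$ between operator spaces is completely bounded if $\sup_n\|u_n\|<\infty$, and two operator spaces are completely isomorphic if there is a linear bijection $u$ between them such that $u$ and $u^{-1}$ are completely bounded. For a set $J$, Pisier's operator Hilbert space $\mathrm{OH}(J)$ is $\ell_2(J)$ with the operator space structure $$\Big\|\sum_{j} a_j\otimes e_j\Big\|_{\mathrm M_n(\mathrm{OH}(J))}=\Big\|\sum_j a_j\otimes \overline{a_j}\Big\|_{\mathrm M_{n^2}}^{1/2}\qquad (a_j\in \mathrm M_n),$$ that is, $\|[x_{kl}]\|=\big\|[\langle x_{kl},x_{k'l'}\rangle]_{(k,k'),(l,l')}\big\|_{\mathrm M_{n^2}}^{1/2}$, the inner product being linear in the first variable; $\mathrm{OH}=\mathrm{OH}(\mathbb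 N)$. The \emph{bounded subsets of $X$ almost completely coarsely embed into $Y$} if there are maps $f^n\colon n\cdot B_X\to Y$, $n\ge 1$, such that the restrictions of $f^n_n$ to $n\cdot B_{\mathrm M_n(X)}$ are equi-coarse embeddings: for every $r>0$ there is $s>0$ such that, for all $n\ge1$ and all $\bar x,\bar z\in n\cdot B_{\mathrm M_n(X)}$, $\|\bar x-\bar z\|\le r$ implies $\|f^n_n(\bar x)-f^n_n(\bar z)\|\le s$; and for every $s>0$ there is $r>0$ such that, for all $n\ge 1$ and all $\bar x,\bar z\in n\cdot B_{\mathrm M_n(X)}$, $\|\bar x-\bar z\|\ge r$ implies $\|f^n_n(\bar x)-f^n_n(\bar z)\|\ge s$. \textbf{Theorem.} Let $X$ be an operator space. (1) If the bounded subsets of $X$ almost completely coarsely embed into $\mathrm{OH}(J)$ for some index set $J$, then $X$ is completely isomorphic to $\mathrm{OH}(I)$ for some index set $I$. (2) If $X$ is infinite-dimensional and the bounded subsets of $X$ almost completely coarsely embed into $\mathrm{OH}$, then $X$ is completely isomorphic to $\mathrm{OH}$. -/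

import Mathlib

/-! Operator spaces, the operator Hilbert spaces `OH J`, complete isomorphisms, and almost complete
coarse embeddings of bounded subsets. -/

noncomputable section

namespace OpSpace

/-- A space `X` together with a norm function on each `M_n(X)`. The two instances used below are
closed linear subspaces of `B(H)` and the operator Hilbert spaces `OH J`. -/
class MatrixNorms (X : Type*) where
  /-- `matNorm n x` is the norm of `x` in `M_n(X)`. -/
  matNorm (n : ℕ) : Matrix (Fin n) (Fin n) X → ℝ

open MatrixNorms (matNorm)

section Concrete

variable {H : Type*} [NormedAddCommGroup H] [InnerProductSpace ℂ H]

/-- The canonical identification `M_n(B(H)) = B(H ⊕ ⋯ ⊕ H)`: the matrix `[T_ij]` acts on the Hilbert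
direct sum of `n` copies of `H` by `(h_j)_j ↦ (∑_j T_ij h_j)_i`. -/
def blockOp {n : ℕ} (T : Matrix (Fin n) (Fin n) (H →L[ℂ] H)) :
    PiLp 2 (fun _ : Fin n => H) →L[ℂ] PiLp 2 (fun _ : Fin n => H) :=
  ((PiLp.continuousLinearEquiv 2 ℂ (fun _ : Fin n => H)).symm :
      (Fin n → H) →L[ℂ] PiLp 2 (fun _ : Fin n => H)) ∘L
    (ContinuousLinearMap.pi fun i => ∑ j, T i j ∘L ContinuousLinearMap.proj j) ∘L
    ((PiLp.continuousLinearEquiv 2 ℂ (fun _ : Fin n => H)) :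
      PiLp 2 (fun _ : Fin n => H) →L[ℂ] (Fin n → H))

/-- The operator space structure of a linear subspace `X ⊆ B(H)`: `M_n(X)` is normed as a subspace
of `M_n(B(H)) = B(H ⊕ ⋯ ⊕ H)`. -/
instance (X : Submodule ℂ (H →L[ℂ] H)) : MatrixNorms X where
  matNorm _ x := ‖blockOp (x.map fun T => (T : H →L[ℂ] H))‖

end Concrete

/-- The underlying Hilbert space `ℓ₂(J)` of Pisier's operator Hilbert space `OH(J)`. -/
def OH (J : Type*) : Type _ := lp (fun _ : J => ℂ) 2

instance (J : Type*) : NormedAddCommGroup (OH J) :=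
  inferInstanceAs (NormedAddCommGroup (lp (fun _ : J => ℂ) 2))

instance (J : Type*) : InnerProductSpace ℂ (OH J) :=
  inferInstanceAs (InnerProductSpace ℂ (lp (fun _ : J => ℂ) 2))

/-- For `x = [x_kl]` in `M_n(ℓ₂(J))`, written as `x = ∑_i a_i ⊗ e_i` with `a_i = [x_kl(i)] ∈ M_n`,
this is the matrix `∑_i a_i ⊗ conj(a_i)` in `M_n ⊗ M_n = M_{n²}`, whose entry at
`((k, k'), (l, l'))` is `∑_i x_kl(i) conj(x_k'l'(i))`, the inner product of `x_kl` and `x_k'l'`. -/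
def OH.gram {J : Type*} {n : ℕ} (x : Matrix (Fin n) (Fin n) (OH J)) :
    Matrix (Fin n × Fin n) (Fin n × Fin n) ℂ :=
  Matrix.of fun p q => inner ℂ (x p.2 q.2) (x p.1 q.1)

/-- The operator space structure of `OH(J)`:
`‖∑_i a_i ⊗ e_i‖ = ‖∑_i a_i ⊗ conj(a_i)‖ ^ (1/2)`, where the norm on the right is the operator norm
of `M_{n²}` acting on the Hilbert space `ℓ₂^{n²}`. -/
instance (J : Type*) : MatrixNorms (OH J) where
  matNorm n x := √ ‖Matrix.toEuclideanCLM (n := Fin n × Fin n) (𝕜 := ℂ) (OH.gram x)‖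

section Maps

variable (X Y : Type*) [NormedAddCommGroup X] [NormedSpace ℂ X] [MatrixNorms X]
  [NormedAddCommGroup Y] [NormedSpace ℂ Y] [MatrixNorms Y]

/-- A linear map is completely bounded if its amplifications `[x_ij] ↦ [u x_ij]` are bounded
uniformly in `n`. -/
def CompletelyBounded {X Y : Type*} [NormedAddCommGroup X] [NormedSpace ℂ X] [MatrixNorms X]
    [NormedAddCommGroup Y] [NormedSpace ℂ Y] [MatrixNorms Y] (u : X →ₗ[ℂ] Y) : Prop :=
  ∃ C : ℝ, ∀ (n : ℕ) (x : Matrix (Fin n) (Fin n) X), matNorm n (x.map u) ≤ C * matNorm n x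

/-- `X` and `Y` are completely isomorphic: there is a linear bijection which is completely bounded
together with its inverse. -/
def CompletelyIsomorphic : Prop :=
  ∃ u : X ≃ₗ[ℂ] Y, CompletelyBounded (u : X →ₗ[ℂ] Y) ∧ CompletelyBounded (u.symm : Y →ₗ[ℂ] X)

/-- The ball `n · B_X`. -/
abbrev Ball (n : ℕ) : Type _ := Metric.closedBall (0 : X) (n : ℝ)

variable {X} in
/-- A matrix with entries in `n · B_X`, regarded as an element of `M_n(X)`. -/
def toMat {n : ℕ} (x : Matrix (Fin n) (Fin n) (Ball X n)) : Matrix (Fin n) (Fin n) X :=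
  x.map fun a => (a : X)

/-- The bounded subsets of `X` almost completely coarsely embed into `Y`: there are maps
`f n : n · B_X → Y`, `n ≥ 1`, such that the restrictions to `n · B_{M_n(X)}` (a subset of
`M_n(n · B_X)`) of the `n`-th amplifications of `f n` are equi-coarse (first clause) and
equi-expanding (second clause). -/
def BoundedSubsetsAlmostCompletelyCoarselyEmbed : Prop :=
  ∃ f : ∀ n : ℕ, Ball X n → Y,
    (∀ r : ℝ, 0 < r → ∃ s : ℝ, 0 < s ∧ ∀ n : ℕ, 1 ≤ n →
      ∀ x z : Matrix (Fin n) (Fin n) (Ball X n),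
        matNorm n (toMat x) ≤ n → matNorm n (toMat z) ≤ n →
        matNorm n (toMat x - toMat z) ≤ r → matNorm n (x.map (f n) - z.map (f n)) ≤ s) ∧
    (∀ s : ℝ, 0 < s → ∃ r : ℝ, 0 < r ∧ ∀ n : ℕ, 1 ≤ n →
      ∀ x z : Matrix (Fin n) (Fin n) (Ball X n),
        matNorm n (toMat x) ≤ n → matNorm n (toMat z) ≤ n →
        r ≤ matNorm n (toMat x - toMat z) → s ≤ matNorm n (x.map (f n) - z.map (f n)))

end Maps

end OpSpace

end

universe u v

noncomputable section

namespace OpSpace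

open MatrixNorms (matNorm)
open scoped ComplexConjugate
open Filter Topology

/-! ### Bounds for block matrices of additive maps -/

/-- The block matrix `T` of additive maps acts on the `ℓ₂`-sum of copies of `E` with norm at most
`C`. -/
def FormBound {κ E : Type*} [Fintype κ] [NormedAddCommGroup E] (T : κ → κ → E →+ E) (C : ℝ) : Prop :=
  ∀ v : κ → E, ∑ p, ‖∑ q, T p q (v q)‖ ^ 2 ≤ C ^ 2 * ∑ q, ‖v q‖ ^ 2

/-- Adding zero rows and columns does not change the norm of a block matrix. -/
theorem formBound_extend_iff {ι κ E : Type*} [Fintype ι] [Fintype κ] [NormedAddCommGroup E]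
    {e : ι → κ} (he : Function.Injective e) {S : ι → ι → E →+ E} {T : κ → κ → E →+ E}
    (hST : ∀ i j, T (e i) (e j) = S i j)
    (hT : ∀ a b, a ∉ Set.range e ∨ b ∉ Set.range e → T a b = 0) (C : ℝ) :
    FormBound T C ↔ FormBound S C := by
  have key : ∀ (v : κ → E), ∑ p, ‖∑ q, T p q (v q)‖ ^ 2 = ∑ p, ‖∑ q, S p q (v (e q))‖ ^ 2 := by
    intro v
    refine (Fintype.sum_of_injective e he _ _ (fun a ha => ?_) fun p => ?_).symm
    · simp [hT a _ (Or.inl ha)]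
    · congr 2
      refine Fintype.sum_of_injective e he _ _ (fun b hb => ?_) fun q => ?_
      · simp [hT _ b (Or.inr hb)]
      · rw [hST]
  constructor
  · intro h v
    have := h (Function.extend e v 0)
    rw [key] at this
    simp only [he.extend_apply] at this
    refine this.trans_eq ?_
    congr 1
    refine (Fintype.sum_of_injective e he _ _ (fun b hb => ?_) fun q => ?_).symm
    · rw [Function.extend_apply' _ _ _ (by simpa using hb)]; simp
    · rw [he.extend_apply]
  · intro h v
    rw [key]
    refine (h fun q => v (e q)).trans ?_
    refine mul_le_mul_of_nonneg_left ?_ (sq_nonneg C)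
    refine (Finset.sum_map Finset.univ ⟨e, he⟩ (fun b => ‖v b‖ ^ 2)).symm.trans_le ?_
    exact Finset.sum_le_sum_of_subset_of_nonneg (Finset.subset_univ _) fun _ _ _ => sq_nonneg _

theorem eq_of_forall_le_iff_of_nonneg {a b : ℝ} (ha : 0 ≤ a) (hb : 0 ≤ b)
    (h : ∀ C, 0 ≤ C → (a ≤ C ↔ b ≤ C)) : a = b :=
  le_antisymm ((h b hb).2 le_rfl) ((h a ha).1 le_rfl)

theorem sqrt_sum_le_mul_sqrt_sum_iff {κ κ' : Type*} [Fintype κ] [Fintype κ'] (f : κ → ℝ) (g : κ' → ℝ) {C : ℝ}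
    (hC : 0 ≤ C) :
    √(∑ p, f p ^ 2) ≤ C * √(∑ q, g q ^ 2) ↔ ∑ p, f p ^ 2 ≤ C ^ 2 * ∑ q, g q ^ 2 := by
  rw [Real.sqrt_le_left (by positivity), mul_pow, Real.sq_sqrt (by positivity)]

/-! ### The norm of a block operator matrix with an arbitrary finite index set -/

section Block

variable {H : Type*} [NormedAddCommGroup H] [InnerProductSpace ℂ H]
  {ι κ : Type*} [Fintype ι] [Fintype κ]

/-- `blockOp` with an arbitrary finite index set. -/
def blockOp' (T : Matrix ι ι (H →L[ℂ] H)) :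
    PiLp 2 (fun _ : ι => H) →L[ℂ] PiLp 2 (fun _ : ι => H) :=
  ((PiLp.continuousLinearEquiv 2 ℂ (fun _ : ι => H)).symm :
      (ι → H) →L[ℂ] PiLp 2 (fun _ : ι => H)) ∘L
    (ContinuousLinearMap.pi fun i => ∑ j, T i j ∘L ContinuousLinearMap.proj j) ∘L
    ((PiLp.continuousLinearEquiv 2 ℂ (fun _ : ι => H)) :
      PiLp 2 (fun _ : ι => H) →L[ℂ] (ι → H))

theorem blockOp'_apply (T : Matrix ι ι (H →L[ℂ] H)) (v : PiLp 2 (fun _ : ι => H)) (i : ι) :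
    blockOp' T v i = ∑ j, T i j (v j) := by
  simp [blockOp']

/-- The norm of a matrix of operators with an arbitrary finite index set. -/
def opNorm' {X : Submodule ℂ (H →L[ℂ] H)} (x : Matrix ι ι X) : ℝ :=
  ‖blockOp' (x.map fun T => (T : H →L[ℂ] H))‖

variable {X : Submodule ℂ (H →L[ℂ] H)}

theorem matNorm_eq_opNorm' {n : ℕ} (x : Matrix (Fin n) (Fin n) X) : matNorm n x = opNorm' x := rfl

theorem opNorm'_nonneg (x : Matrix ι ι X) : 0 ≤ opNorm' x :=
  ContinuousLinearMap.opNorm_nonneg _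

theorem opNorm'_le_iff (x : Matrix ι ι X) {C : ℝ} (hC : 0 ≤ C) :
    opNorm' x ≤ C ↔ FormBound (fun i j => ((x i j : H →L[ℂ] H) : H →ₗ[ℂ] H).toAddMonoidHom) C := by
  rw [opNorm', ContinuousLinearMap.opNorm_le_iff hC]
  have : ∀ v : PiLp 2 (fun _ : ι => H),
      ‖blockOp' (x.map fun T => (T : H →L[ℂ] H)) v‖ ≤ C * ‖v‖ ↔
      ∑ p, ‖∑ q, (x p q : H →L[ℂ] H) (v q)‖ ^ 2 ≤ C ^ 2 * ∑ q, ‖v q‖ ^ 2 := by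
    intro v
    rw [PiLp.norm_eq_of_L2, PiLp.norm_eq_of_L2, sqrt_sum_le_mul_sqrt_sum_iff _ _ hC]
    simp only [blockOp'_apply, Matrix.map_apply]
  simp only [this]
  exact ⟨fun h v => h (WithLp.toLp 2 v), fun h v => h v⟩

theorem opNorm'_smul_le (c : ℂ) (x : Matrix ι ι X) : opNorm' (c • x) ≤ ‖c‖ * opNorm' x := by
  rw [opNorm'_le_iff _ (mul_nonneg (norm_nonneg c) (opNorm'_nonneg x))]
  intro v
  have := (opNorm'_le_iff x (opNorm'_nonneg x)).1 le_rfl v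
  have h : ∀ p, ∑ q, (((c • x) p q : H →L[ℂ] H) : H →ₗ[ℂ] H).toAddMonoidHom (v q) =
      c • ∑ q, ((x p q : H →L[ℂ] H) : H →ₗ[ℂ] H).toAddMonoidHom (v q) := by
    intro p
    rw [Finset.smul_sum]
    rfl
  simp only [h, norm_smul, mul_pow, ← Finset.mul_sum, mul_assoc]
  gcongr

theorem opNorm'_smul (c : ℂ) (x : Matrix ι ι X) : opNorm' (c • x) = ‖c‖ * opNorm' x := by
  refine le_antisymm (opNorm'_smul_le c x) ?_
  rcases eq_or_ne c 0 with rfl | hc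
  · simpa using opNorm'_nonneg _
  · have := opNorm'_smul_le c⁻¹ (c • x)
    rwa [smul_smul, inv_mul_cancel₀ hc, one_smul, norm_inv,
      le_inv_mul_iff₀ (norm_pos_iff.2 hc)] at this

theorem opNorm'_extend {e : ι → κ} (he : Function.Injective e) {x : Matrix ι ι X} {y : Matrix κ κ X}
    (hxy : ∀ i j, y (e i) (e j) = x i j)
    (hy : ∀ a b, a ∉ Set.range e ∨ b ∉ Set.range e → y a b = 0) : opNorm' y = opNorm' x := by
  refine eq_of_forall_le_iff_of_nonneg (opNorm'_nonneg _) (opNorm'_nonneg _) fun C hC => ?_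
  rw [opNorm'_le_iff _ hC, opNorm'_le_iff _ hC]
  refine formBound_extend_iff he (fun i j => ?_) (fun a b hab => ?_) C
  · rw [hxy]
  · rw [hy a b hab]; rfl

theorem norm_entry_le_opNorm' (x : Matrix ι ι X) (i j : ι) : ‖x i j‖ ≤ opNorm' x := by
  classical
  refine ContinuousLinearMap.opNorm_le_bound _ (opNorm'_nonneg x) fun h => ?_
  have := (opNorm'_le_iff x (opNorm'_nonneg x)).1 le_rfl (Pi.single j h)
  rw [← sqrt_sum_le_mul_sqrt_sum_iff _ _ (opNorm'_nonneg x)] at this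
  have h1 : ∑ q, ‖(Pi.single j h : ι → H) q‖ ^ 2 = ‖h‖ ^ 2 := by
    rw [Finset.sum_eq_single j] <;> simp +contextual
  rw [h1, Real.sqrt_sq (norm_nonneg _)] at this
  refine le_trans (Real.le_sqrt_of_sq_le ?_) this
  have h2 : ∀ p, ∑ q, ((x p q : H →L[ℂ] H) : H →ₗ[ℂ] H).toAddMonoidHom
      ((Pi.single j h : ι → H) q) = (x p j : H →L[ℂ] H) h := by
    intro p
    rw [Finset.sum_eq_single j]
    · simp
    · intro b _ hb; simp [hb]
    · simp
  simp only [h2]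
  exact Finset.single_le_sum (f := fun p => ‖(x p j : H →L[ℂ] H) h‖ ^ 2)
    (fun _ _ => sq_nonneg _) (Finset.mem_univ i)

theorem opNorm'_le_card_mul (x : Matrix ι ι X) {M : ℝ} (hM : 0 ≤ M) (h : ∀ i j, ‖x i j‖ ≤ M) :
    opNorm' x ≤ Fintype.card ι * M := by
  rw [opNorm'_le_iff _ (by positivity)]
  intro v
  have h1 : ∀ p, ‖∑ q, ((x p q : H →L[ℂ] H) : H →ₗ[ℂ] H).toAddMonoidHom (v q)‖ ^ 2 ≤
      Fintype.card ι * (M ^ 2 * ∑ q, ‖v q‖ ^ 2) := by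
    intro p
    have h2 : ‖∑ q, ((x p q : H →L[ℂ] H) : H →ₗ[ℂ] H).toAddMonoidHom (v q)‖ ≤
        ∑ q, M * ‖v q‖ :=
      (norm_sum_le _ _).trans (Finset.sum_le_sum fun q _ =>
        (x p q : H →L[ℂ] H).le_of_opNorm_le (h p q) (v q))
    calc _ ≤ (∑ q, M * ‖v q‖) ^ 2 := by gcongr
      _ ≤ Fintype.card ι * ∑ q, (M * ‖v q‖) ^ 2 := sq_sum_le_card_mul_sum_sq
      _ = _ := by simp only [mul_pow, Finset.mul_sum]
  refine (Finset.sum_le_sum fun p _ => h1 p).trans_eq ?_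
  rw [Finset.sum_const, Finset.card_univ, nsmul_eq_mul]
  ring

/-- If `A` is a real matrix with orthogonal columns of norm `c`, then `A ⊗ h` has norm at most
`c ‖h‖`. -/
theorem opNorm'_smul_const_le (A : Matrix ι ι ℝ) {c : ℝ} (hc : 0 ≤ c) [DecidableEq ι]
    (hA : ∀ j k, ∑ i, A i j * A i k = if j = k then c ^ 2 else 0) (h : X) :
    opNorm' (Matrix.of fun i j => ((A i j : ℂ) • h) : Matrix ι ι X) ≤ c * ‖h‖ := by
  rw [opNorm'_le_iff _ (by positivity)]
  intro v
  set w : ι → H := fun j => (h : H →L[ℂ] H) (v j) with hw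
  have h1 : ∑ p, ‖∑ q, (A p q : ℂ) • w q‖ ^ 2 = c ^ 2 * ∑ q, ‖w q‖ ^ 2 := by
    have hexp : ∀ p, ((‖∑ q, (A p q : ℂ) • w q‖ ^ 2 : ℝ) : ℂ) =
        ∑ j, ∑ k, ((A p j * A p k : ℝ) : ℂ) * inner ℂ (w j) (w k) := by
      intro p
      have h0 := inner_self_eq_norm_sq_to_K (𝕜 := ℂ) (∑ q, (A p q : ℂ) • w q)
      simp only [sum_inner, inner_sum, inner_smul_left, inner_smul_right, Complex.conj_ofReal,
        Complex.coe_algebraMap] at h0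
      rw [Complex.ofReal_pow, ← h0]
      simp only [Finset.mul_sum]
      rw [Finset.sum_comm]
      refine Finset.sum_congr rfl fun j _ => ?_
      refine Finset.sum_congr rfl fun k _ => ?_
      push_cast
      ring
    have : ((∑ p, ‖∑ q, (A p q : ℂ) • w q‖ ^ 2 : ℝ) : ℂ) = (c ^ 2 * ∑ q, ‖w q‖ ^ 2 : ℝ) := by
      simp only [Complex.ofReal_sum, hexp]
      rw [Finset.sum_comm]
      rw [Complex.ofReal_mul, Complex.ofReal_sum, Finset.mul_sum]
      refine Finset.sum_congr rfl fun j _ => ?_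
      rw [Finset.sum_comm, Finset.sum_eq_single j]
      · rw [← Finset.sum_mul, ← Complex.ofReal_sum, hA, if_pos rfl,
          inner_self_eq_norm_sq_to_K (𝕜 := ℂ) (w j)]
        simp
      · intro k _ hk
        rw [← Finset.sum_mul, ← Complex.ofReal_sum, hA, if_neg hk.symm]
        simp
      · simp
    exact_mod_cast this
  refine le_trans (le_of_eq ?_) (h1.le.trans ?_)
  · rfl
  · rw [mul_pow, mul_assoc]
    refine mul_le_mul_of_nonneg_left ?_ (sq_nonneg c)
    rw [Finset.mul_sum]
    refine Finset.sum_le_sum fun q _ => ?_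
    rw [← mul_pow]
    refine pow_le_pow_left₀ (norm_nonneg _) ?_ 2
    exact (h : H →L[ℂ] H).le_opNorm _

end Block

/-! ### Matrices indexed by pairs -/

section KerNorm

variable {κ : Type*} [Fintype κ] [DecidableEq κ]

/-- The operator norm of a complex matrix acting on a finite-dimensional `ℓ₂`-space. -/
def kerNorm (Γ : Matrix κ κ ℂ) : ℝ := ‖Matrix.toEuclideanCLM (n := κ) (𝕜 := ℂ) Γ‖

theorem kerNorm_nonneg (Γ : Matrix κ κ ℂ) : 0 ≤ kerNorm Γ := norm_nonneg _

theorem kerNorm_add_le (Γ Δ : Matrix κ κ ℂ) : kerNorm (Γ + Δ) ≤ kerNorm Γ + kerNorm Δ := by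
  rw [kerNorm, map_add]
  exact norm_add_le _ _

theorem kerNorm_smul (c : ℂ) (Γ : Matrix κ κ ℂ) : kerNorm (c • Γ) = ‖c‖ * kerNorm Γ := by
  rw [kerNorm, map_smul, norm_smul, kerNorm]

theorem kerNorm_le_iff (Γ : Matrix κ κ ℂ) {C : ℝ} (hC : 0 ≤ C) :
    kerNorm Γ ≤ C ↔ FormBound (fun p q => AddMonoidHom.mulLeft (Γ p q)) C := by
  rw [kerNorm, ContinuousLinearMap.opNorm_le_iff hC]
  have : ∀ v : EuclideanSpace ℂ κ,
      ‖Matrix.toEuclideanCLM (n := κ) (𝕜 := ℂ) Γ v‖ ≤ C * ‖v‖ ↔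
      ∑ p, ‖∑ q, Γ p q * v q‖ ^ 2 ≤ C ^ 2 * ∑ q, ‖v q‖ ^ 2 := by
    intro v
    rw [EuclideanSpace.norm_eq, EuclideanSpace.norm_eq, sqrt_sum_le_mul_sqrt_sum_iff _ _ hC]
    simp only [Matrix.ofLp_toEuclideanCLM, Matrix.mulVec, dotProduct]
  simp only [this]
  exact ⟨fun h v => h (WithLp.toLp 2 v), fun h v => h v⟩

theorem kerNorm_extend {κ' : Type*} [Fintype κ'] [DecidableEq κ'] {e : κ → κ'}
    (he : Function.Injective e) {Γ : Matrix κ κ ℂ} {Δ : Matrix κ' κ' ℂ}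
    (h : ∀ i j, Δ (e i) (e j) = Γ i j)
    (h0 : ∀ a b, a ∉ Set.range e ∨ b ∉ Set.range e → Δ a b = 0) : kerNorm Δ = kerNorm Γ := by
  refine eq_of_forall_le_iff_of_nonneg (kerNorm_nonneg _) (kerNorm_nonneg _) fun C hC => ?_
  rw [kerNorm_le_iff _ hC, kerNorm_le_iff _ hC]
  refine formBound_extend_iff he (fun i j => by rw [h]) (fun a b hab => ?_) C
  ext
  simp [h0 a b hab]

theorem tendsto_kerNorm {α : Type*} {l : Filter α} {Γ : α → Matrix κ κ ℂ} {Δ : Matrix κ κ ℂ}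
    (h : ∀ p q, Filter.Tendsto (fun a => Γ a p q) l (nhds (Δ p q))) :
    Filter.Tendsto (fun a => kerNorm (Γ a)) l (nhds (kerNorm Δ)) := by
  have hc : Continuous fun Γ : Matrix κ κ ℂ => Matrix.toEuclideanCLM (n := κ) (𝕜 := ℂ) Γ :=
    LinearMap.continuous_of_finiteDimensional
      (Matrix.toEuclideanCLM (n := κ) (𝕜 := ℂ)).toAlgEquiv.toLinearMap
  have h' : Filter.Tendsto Γ l (nhds Δ) :=
    tendsto_pi_nhds.2 fun p => tendsto_pi_nhds.2 fun q => h p q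
  exact (hc.norm.tendsto Δ).comp h'

theorem inner_toEuclideanCLM_eq_sum (Γ : Matrix κ κ ℂ) (s t : EuclideanSpace ℂ κ) :
    inner ℂ s (Matrix.toEuclideanCLM (n := κ) (𝕜 := ℂ) Γ t) =
      ∑ p, ∑ q, conj (s p) * Γ p q * t q := by
  simp only [PiLp.inner_apply, Matrix.ofLp_toEuclideanCLM, Matrix.mulVec, dotProduct,
    RCLike.inner_apply', Finset.mul_sum, mul_assoc]

theorem norm_inner_toEuclideanCLM_le (Γ : Matrix κ κ ℂ) (s t : EuclideanSpace ℂ κ) :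
    ‖inner ℂ s (Matrix.toEuclideanCLM (n := κ) (𝕜 := ℂ) Γ t)‖ ≤ kerNorm Γ * ‖s‖ * ‖t‖ := by
  refine (norm_inner_le_norm _ _).trans ?_
  have := ContinuousLinearMap.le_opNorm (Matrix.toEuclideanCLM (n := κ) (𝕜 := ℂ) Γ) t
  calc _ ≤ ‖s‖ * (kerNorm Γ * ‖t‖) := by gcongr; exact this
    _ = _ := by ring

end KerNorm

section PosKer

variable {ι : Type*}

/-- The tensor `ξ ⊗ conj ξ`. -/
def rankOne (ξ : ι → ℂ) : EuclideanSpace ℂ (ι × ι) := WithLp.toLp 2 fun q => ξ q.1 * conj (ξ q.2)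

/-- A vector of `ℓ₂(ι × ι)` which is Hermitian as a matrix. -/
def IsHerm (t : EuclideanSpace ℂ (ι × ι)) : Prop := ∀ q, t q.swap = conj (t q)

theorem exists_isHerm_decomposition (t : EuclideanSpace ℂ (ι × ι)) :
    ∃ a b : EuclideanSpace ℂ (ι × ι), IsHerm a ∧ IsHerm b ∧ t = a + Complex.I • b := by
  refine ⟨WithLp.toLp 2 fun q => (t q + conj (t q.swap)) / 2,
    WithLp.toLp 2 fun q => (t q - conj (t q.swap)) / (2 * Complex.I), fun q => ?_, fun q => ?_, ?_⟩
  · simp only [Prod.swap_swap, map_div₀, map_add, Complex.conj_conj, Complex.conj_ofNat, add_comm]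
  · simp only [Prod.swap_swap, map_div₀, map_sub, map_mul, Complex.conj_conj, Complex.conj_I,
      Complex.conj_ofNat]
    rw [mul_neg, div_neg, ← neg_div, neg_sub]
  · ext q
    simp only [PiLp.add_apply, PiLp.smul_apply, smul_eq_mul]
    field_simp
    ring

variable [Fintype ι]

theorem IsHerm.norm_add_I_smul_sq {a b : EuclideanSpace ℂ (ι × ι)} (ha : IsHerm a) (hb : IsHerm b) :
    ‖a + Complex.I • b‖ ^ 2 = ‖a‖ ^ 2 + ‖b‖ ^ 2 := by
  have him : (inner ℂ a b).im = 0 := by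
    rw [← Complex.conj_eq_iff_im]
    simp only [PiLp.inner_apply, RCLike.inner_apply', map_sum, map_mul]
    refine Fintype.sum_equiv (Equiv.prodComm ι ι) _ _ fun q => ?_
    rw [Equiv.prodComm_apply, ha q, hb q]
  rw [@norm_add_sq ℂ, inner_smul_right, norm_smul, Complex.norm_I, one_mul]
  simp [him]

variable [DecidableEq ι]

/-- The matrices `Γ` indexed by pairs such that the map `t ↦ Γ t` of `M_n` preserves Hermitian
and positive matrices. -/
structure PosKer (Γ : Matrix (ι × ι) (ι × ι) ℂ) : Prop where
  symm : ∀ p q, Γ p.swap q.swap = conj (Γ p q)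
  pos : ∀ α ξ : ι → ℂ,
    0 ≤ (inner ℂ (rankOne α) (Matrix.toEuclideanCLM (n := ι × ι) (𝕜 := ℂ) Γ (rankOne ξ))).re

theorem PosKer.add {Γ Δ : Matrix (ι × ι) (ι × ι) ℂ} (hΓ : PosKer Γ) (hΔ : PosKer Δ) :
    PosKer (Γ + Δ) where
  symm p q := by simp [hΓ.symm, hΔ.symm]
  pos α ξ := by
    rw [map_add, add_apply, inner_add_right, Complex.add_re]
    exact add_nonneg (hΓ.pos α ξ) (hΔ.pos α ξ)

theorem PosKer.isHerm {Γ : Matrix (ι × ι) (ι × ι) ℂ} (hΓ : PosKer Γ)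
    {t : EuclideanSpace ℂ (ι × ι)} (ht : IsHerm t) :
    IsHerm (Matrix.toEuclideanCLM (n := ι × ι) (𝕜 := ℂ) Γ t) := by
  intro p
  simp only [Matrix.ofLp_toEuclideanCLM, Matrix.mulVec, dotProduct, map_sum, map_mul]
  refine Fintype.sum_equiv (Equiv.prodComm ι ι) _ _ fun q => ?_
  have h1 := hΓ.symm p q.swap
  have h2 := ht q
  rw [Prod.swap_swap] at h1
  rw [h1, Equiv.prodComm_apply, h2, Complex.conj_conj]

/-- Spectral decomposition of a Hermitian vector of `ℓ₂(ι × ι)`. -/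
theorem IsHerm.exists_decomposition {t : EuclideanSpace ℂ (ι × ι)} (ht : IsHerm t) :
    ∃ (ξ : ι → ι → ℂ) (c : ι → ℝ), Orthonormal ℂ (fun i => rankOne (ξ i)) ∧
      t = ∑ i, (c i : ℂ) • rankOne (ξ i) := by
  set M : Matrix ι ι ℂ := Matrix.of fun k l => t (k, l) with hM
  have hMh : M.IsHermitian := by
    ext k l
    exact (ht (l, k)).symm
  refine ⟨fun i => (hMh.eigenvectorBasis i).ofLp, hMh.eigenvalues, ?_, ?_⟩
  · have key : ∀ i j, inner ℂ (rankOne (hMh.eigenvectorBasis i).ofLp)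
        (rankOne (hMh.eigenvectorBasis j).ofLp) = inner ℂ (hMh.eigenvectorBasis i)
          (hMh.eigenvectorBasis j) * conj (inner ℂ (hMh.eigenvectorBasis i)
          (hMh.eigenvectorBasis j)) := by
      intro i j
      simp only [PiLp.inner_apply, rankOne, RCLike.inner_apply', map_sum, Finset.sum_mul_sum,
        Fintype.sum_prod_type, map_mul, Complex.conj_conj]
      refine Finset.sum_congr rfl fun k _ => Finset.sum_congr rfl fun l _ => ?_
      ring
    rw [orthonormal_iff_ite]
    intro i j
    rw [key, orthonormal_iff_ite.1 hMh.eigenvectorBasis.orthonormal i j]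
    split_ifs <;> simp
  · ext ⟨k, l⟩
    have h := congrFun (congrFun hMh.spectral_theorem k) l
    rw [Unitary.conjStarAlgAut_apply, Matrix.mul_apply] at h
    simp only [Matrix.mul_diagonal, Matrix.star_apply, Matrix.IsHermitian.eigenvectorUnitary_apply]
      at h
    have hl : t (k, l) = M k l := rfl
    rw [hl, h]
    simp only [rankOne, WithLp.ofLp_sum, WithLp.ofLp_smul, Finset.sum_apply, Pi.smul_apply,
      smul_eq_mul, Function.comp_apply]
    refine Finset.sum_congr rfl fun i _ => ?_
    simp only [RCLike.star_def, Complex.coe_algebraMap]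
    ring

theorem norm_sum_smul_eq_of_abs_eq {κ E : Type*} [Fintype κ] [NormedAddCommGroup E]
    [InnerProductSpace ℂ E] {v : κ → E} (hv : Orthonormal ℂ v) (c : κ → ℝ) :
    ‖∑ i, ((|c i| : ℝ) : ℂ) • v i‖ = ‖∑ i, (c i : ℂ) • v i‖ := by
  have h : ∀ d : κ → ℝ, ((‖∑ i, (d i : ℂ) • v i‖ ^ 2 : ℝ) : ℂ) = ((∑ i, d i ^ 2 : ℝ) : ℂ) := by
    intro d
    have h1 := hv.inner_sum (fun i => (d i : ℂ)) (fun i => (d i : ℂ)) Finset.univ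
    rw [inner_self_eq_norm_sq_to_K] at h1
    push_cast
    refine h1.trans (Finset.sum_congr rfl fun i _ => ?_)
    rw [Complex.conj_ofReal, sq]
  have h1 := Complex.ofReal_injective (h c)
  have h2 := Complex.ofReal_injective (h fun i => |c i|)
  simp only [sq_abs] at h2
  rw [← h1] at h2
  exact (sq_eq_sq₀ (norm_nonneg _) (norm_nonneg _)).1 h2

theorem PosKer.re_inner_le {Γ Δ : Matrix (ι × ι) (ι × ι) ℂ} (hΓ : PosKer Γ) (hΔ : PosKer Δ)
    {s t : EuclideanSpace ℂ (ι × ι)} (hs : IsHerm s) (ht : IsHerm t) :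
    (inner ℂ s (Matrix.toEuclideanCLM (n := ι × ι) (𝕜 := ℂ) Γ t)).re ≤
      kerNorm (Γ + Δ) * ‖s‖ * ‖t‖ := by
  obtain ⟨α, a, hα, rfl⟩ := hs.exists_decomposition
  obtain ⟨ξ, b, hξ, rfl⟩ := ht.exists_decomposition
  have hexp : ∀ (Γ : Matrix (ι × ι) (ι × ι) ℂ) (a b : ι → ℝ),
      (inner ℂ (∑ i, (a i : ℂ) • rankOne (α i)) (Matrix.toEuclideanCLM (n := ι × ι) (𝕜 := ℂ) Γ
        (∑ i, (b i : ℂ) • rankOne (ξ i)))).re = ∑ i, ∑ j, a i * b j *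
        (inner ℂ (rankOne (α i))
          (Matrix.toEuclideanCLM (n := ι × ι) (𝕜 := ℂ) Γ (rankOne (ξ j)))).re := by
    intro Γ a b
    simp only [map_sum, map_smul, sum_inner, inner_sum, inner_smul_left, inner_smul_right,
      Complex.conj_ofReal, Complex.re_sum, Complex.re_ofReal_mul, mul_assoc]
    simp only [Finset.mul_sum]
    rw [Finset.sum_comm]
    refine Finset.sum_congr rfl fun i _ => Finset.sum_congr rfl fun j _ => ?_
    ring
  have h1 : (inner ℂ (∑ i, (a i : ℂ) • rankOne (α i))
      (Matrix.toEuclideanCLM (n := ι × ι) (𝕜 := ℂ) Γ (∑ i, (b i : ℂ) • rankOne (ξ i)))).re ≤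
      (inner ℂ (∑ i, ((|a i| : ℝ) : ℂ) • rankOne (α i))
      (Matrix.toEuclideanCLM (n := ι × ι) (𝕜 := ℂ) (Γ + Δ)
        (∑ i, ((|b i| : ℝ) : ℂ) • rankOne (ξ i)))).re := by
    rw [hexp, hexp]
    refine Finset.sum_le_sum fun i _ => Finset.sum_le_sum fun j _ => ?_
    rw [map_add, add_apply, inner_add_right, Complex.add_re, ← abs_mul]
    refine mul_le_mul (le_abs_self _) ?_ (hΓ.pos _ _) (abs_nonneg _)
    exact le_add_of_nonneg_right (hΔ.pos _ _)
  refine h1.trans ((Complex.re_le_norm _).trans ((norm_inner_toEuclideanCLM_le _ _ _).trans ?_))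
  rw [norm_sum_smul_eq_of_abs_eq hα, norm_sum_smul_eq_of_abs_eq hξ]

/-- Monotonicity of the norm on positivity preserving maps of `M_n` with its Hilbert-Schmidt norm. -/
theorem PosKer.kerNorm_le_add {Γ Δ : Matrix (ι × ι) (ι × ι) ℂ} (hΓ : PosKer Γ) (hΔ : PosKer Δ) :
    kerNorm Γ ≤ kerNorm (Γ + Δ) := by
  set C := kerNorm (Γ + Δ) with hC
  have hC0 : 0 ≤ C := kerNorm_nonneg _
  have hherm : ∀ t : EuclideanSpace ℂ (ι × ι), IsHerm t →
      ‖Matrix.toEuclideanCLM (n := ι × ι) (𝕜 := ℂ) Γ t‖ ≤ C * ‖t‖ := by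
    intro t ht
    set s := Matrix.toEuclideanCLM (n := ι × ι) (𝕜 := ℂ) Γ t with hs
    have h := hΓ.re_inner_le hΔ (hΓ.isHerm ht) ht
    rw [← hs, ← hC] at h
    have h2 : (inner ℂ s s).re = ‖s‖ ^ 2 := (norm_sq_eq_re_inner (𝕜 := ℂ) s).symm
    rw [h2] at h
    rcases (norm_nonneg s).eq_or_lt with h0 | h0
    · rw [← h0]; positivity
    · refine le_of_mul_le_mul_left ?_ h0
      nlinarith
  refine ContinuousLinearMap.opNorm_le_bound _ hC0 fun t => ?_
  obtain ⟨a, b, ha, hb, rfl⟩ := exists_isHerm_decomposition t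
  refine abs_le_of_sq_le_sq' ?_ (by positivity) |>.2
  rw [map_add, map_smul, (hΓ.isHerm ha).norm_add_I_smul_sq (hΓ.isHerm hb), mul_pow,
    ha.norm_add_I_smul_sq hb, mul_add, ← mul_pow, ← mul_pow]
  have := hherm a ha
  have := hherm b hb
  gcongr

theorem kerNorm_swap (Γ : Matrix (ι × ι) (ι × ι) ℂ) :
    kerNorm (Γ.submatrix Prod.swap Prod.swap) = kerNorm Γ :=
  (kerNorm_extend (e := Prod.swap) Prod.swap_injective (fun _ _ => rfl) (fun a b h => by
    rcases h with h | h <;> exact absurd (Prod.swap_surjective _) h)).symm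

theorem PosKer.swap {Γ : Matrix (ι × ι) (ι × ι) ℂ} (hΓ : PosKer Γ) :
    PosKer (Γ.submatrix Prod.swap Prod.swap) where
  symm p q := hΓ.symm p.swap q.swap
  pos α ξ := by
    have h := hΓ.pos (fun i => conj (α i)) (fun i => conj (ξ i))
    refine h.trans_eq (congrArg Complex.re ?_)
    rw [inner_toEuclideanCLM_eq_sum, inner_toEuclideanCLM_eq_sum]
    refine Fintype.sum_equiv (Equiv.prodComm ι ι) _ _ fun p => ?_
    refine Fintype.sum_equiv (Equiv.prodComm ι ι) _ _ fun q => ?_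
    simp only [rankOne, Equiv.prodComm_apply, Matrix.submatrix_apply, Prod.swap_swap, Prod.fst_swap,
      Prod.snd_swap, map_mul, Complex.conj_conj]
    ring

end PosKer

/-! ### Gram matrices -/

section Gram

variable {E ι : Type*} [NormedAddCommGroup E] [InnerProductSpace ℂ E]

/-- The matrix of inner products of the entries of a matrix over an inner product space. -/
def gram (x : Matrix ι ι E) : Matrix (ι × ι) (ι × ι) ℂ :=
  Matrix.of fun p q => inner ℂ (x p.2 q.2) (x p.1 q.1)

theorem gram_smul (c : ℂ) (x : Matrix ι ι E) : gram (c • x) = ((‖c‖ : ℂ) ^ 2) • gram x := by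
  ext p q
  simp only [gram, Matrix.of_apply, Matrix.smul_apply, inner_smul_left, inner_smul_right,
    smul_eq_mul, ← mul_assoc, ← Complex.mul_conj']

theorem gram_add_gram_sub (x y : Matrix ι ι E) :
    gram (x + y) + gram (x - y) = (2 : ℂ) • (gram x + gram y) := by
  ext p q
  simp only [gram, Matrix.of_apply, Matrix.smul_apply, Matrix.add_apply, Matrix.sub_apply,
    inner_add_left, inner_add_right, inner_sub_left, inner_sub_right, smul_eq_mul]
  ring

variable [Fintype ι] [DecidableEq ι]

theorem inner_rankOne_gram (x : Matrix ι ι E) (α ξ : ι → ℂ) :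
    inner ℂ (rankOne α) (Matrix.toEuclideanCLM (n := ι × ι) (𝕜 := ℂ) (gram x) (rankOne ξ)) =
      ((‖∑ k, ∑ l, (conj (α k) * ξ l) • x k l‖ ^ 2 : ℝ) : ℂ) := by
  rw [inner_toEuclideanCLM_eq_sum]
  have h := inner_self_eq_norm_sq_to_K (𝕜 := ℂ) (∑ k, ∑ l, (conj (α k) * ξ l) • x k l)
  rw [Complex.ofReal_pow]
  refine Eq.trans ?_ h
  simp only [sum_inner, inner_sum, inner_smul_left, inner_smul_right, Fintype.sum_prod_type,
    Finset.mul_sum, rankOne, gram, Matrix.of_apply, map_mul, Complex.conj_conj]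
  refine Finset.sum_congr rfl fun k _ => ?_
  rw [Finset.sum_comm (s := Finset.univ) (t := Finset.univ) (f := fun l k' => ∑ l', _)]
  refine Finset.sum_congr rfl fun k' _ => ?_
  refine Finset.sum_congr rfl fun l _ => Finset.sum_congr rfl fun l' _ => ?_
  ring

theorem posKer_gram (x : Matrix ι ι E) : PosKer (gram x) where
  symm p q := by simp [gram]
  pos α ξ := by
    rw [inner_rankOne_gram, Complex.ofReal_re]
    positivity

theorem kerNorm_gram_add_le (x y : Matrix ι ι E) :
    kerNorm (gram (x + y)) ≤ 2 * (kerNorm (gram x) + kerNorm (gram y)) := by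
  refine ((posKer_gram (x + y)).kerNorm_le_add (posKer_gram (x - y))).trans ?_
  rw [gram_add_gram_sub, kerNorm_smul, Complex.norm_ofNat]
  gcongr
  exact kerNorm_add_le _ _

/-- The norm of a matrix over an operator Hilbert space, for an arbitrary finite index set. -/
def gramNorm (x : Matrix ι ι E) : ℝ := √(kerNorm (gram x))

theorem gramNorm_nonneg (x : Matrix ι ι E) : 0 ≤ gramNorm x := Real.sqrt_nonneg _

theorem gramNorm_sq (x : Matrix ι ι E) : gramNorm x ^ 2 = kerNorm (gram x) :=
  Real.sq_sqrt (kerNorm_nonneg _)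

theorem matNorm_eq_gramNorm {J : Type*} {n : ℕ} (x : Matrix (Fin n) (Fin n) (OH J)) :
    matNorm n x = gramNorm x := rfl

theorem norm_sum_entries_le (x : Matrix ι ι E) :
    ‖∑ k, ∑ l, x k l‖ ≤ Fintype.card ι * gramNorm x := by
  have h := inner_rankOne_gram x (fun _ => 1) (fun _ => 1)
  have h2 := norm_inner_toEuclideanCLM_le (gram x) (rankOne fun _ => 1) (rankOne fun _ => 1)
  have h3 : ‖rankOne (fun _ : ι => (1 : ℂ))‖ = Fintype.card ι := by
    rw [EuclideanSpace.norm_eq]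
    simp [rankOne]
  rw [h, h3, Complex.norm_real, Real.norm_of_nonneg (by positivity), ← gramNorm_sq] at h2
  simp only [map_one, one_mul, one_smul] at h2
  refine abs_le_of_sq_le_sq' ?_ (mul_nonneg (Nat.cast_nonneg _) (gramNorm_nonneg x)) |>.2
  linarith

theorem gramNorm_extend {κ : Type*} [Fintype κ] [DecidableEq κ] {e : ι → κ}
    (he : Function.Injective e) {x : Matrix ι ι E} {y : Matrix κ κ E}
    (hxy : ∀ i j, y (e i) (e j) = x i j)
    (hy : ∀ a b, a ∉ Set.range e ∨ b ∉ Set.range e → y a b = 0) : gramNorm y = gramNorm x := by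
  rw [gramNorm, gramNorm]
  congr 1
  refine kerNorm_extend (e := Prod.map e e) (he.prodMap he) (fun p q => ?_) (fun p q h => ?_)
  · simp [gram, hxy]
  · simp only [Set.range_prodMap, Set.mem_prod, not_and_or] at h
    simp only [gram, Matrix.of_apply]
    rcases h with (h | h) | (h | h)
    · rw [hy p.1 q.1 (Or.inl h), inner_zero_right]
    · rw [hy p.2 q.2 (Or.inl h), inner_zero_left]
    · rw [hy p.1 q.1 (Or.inr h), inner_zero_right]
    · rw [hy p.2 q.2 (Or.inr h), inner_zero_left]

end Gram

/-! ### Sylvester matrices -/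

/-- The Sylvester matrix of size `2 ^ k`. -/
def sylvester (k : ℕ) : Matrix (Fin k → Bool) (Fin k → Bool) ℝ :=
  Matrix.of fun s t => ∏ i, if s i && t i then -1 else 1

theorem sylvester_eq_one_or (k : ℕ) (s t : Fin k → Bool) :
    sylvester k s t = 1 ∨ sylvester k s t = -1 := by
  rw [← sq_eq_one_iff, sylvester, Matrix.of_apply, ← Finset.prod_pow]
  refine Finset.prod_eq_one fun i _ => ?_
  split_ifs <;> norm_num

theorem sylvester_columns (k : ℕ) (s t : Fin k → Bool) :
    ∑ i, sylvester k i s * sylvester k i t = if s = t then 2 ^ k else 0 := by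
  have h := Finset.prod_univ_sum (fun _ : Fin k => (Finset.univ : Finset Bool))
    (fun i b => (if b && s i then (-1 : ℝ) else 1) * (if b && t i then (-1 : ℝ) else 1))
  rw [Fintype.piFinset_univ] at h
  simp only [sylvester, Matrix.of_apply, ← Finset.prod_mul_distrib]
  rw [← h]
  split_ifs with hst
  · subst hst
    rw [Finset.prod_congr rfl (g := fun _ => (2 : ℝ))]
    · simp
    · intro i _
      cases s i <;> norm_num
  · obtain ⟨i, hi⟩ := Function.ne_iff.1 hst
    refine Finset.prod_eq_zero (Finset.mem_univ i) ?_
    revert hi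
    cases s i <;> cases t i <;> simp

theorem sum_sylvester (k : ℕ) : ∑ s, ∑ t, sylvester k s t = 2 ^ k := by
  have h1 : ∀ s : Fin k → Bool, ∑ t, sylvester k s t =
      ∏ i, ∑ b : Bool, if s i && b then (-1 : ℝ) else 1 := by
    intro s
    rw [Finset.prod_univ_sum, Fintype.piFinset_univ]
    rfl
  have h2 := Finset.prod_univ_sum (fun _ : Fin k => (Finset.univ : Finset Bool))
    (fun _ a => ∑ b : Bool, if a && b then (-1 : ℝ) else 1)
  rw [Fintype.piFinset_univ] at h2
  simp only [h1]
  rw [← h2]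
  simp
  norm_num

/-! ### Maps whose amplifications satisfy coarse bounds -/

/-- The properties of the norms of matrices over an operator space used below. -/
structure IsMatrixNorm {X : Type*} [NormedAddCommGroup X] [NormedSpace ℂ X]
    (ν : ∀ (ι : Type) [Fintype ι], Matrix ι ι X → ℝ) : Prop where
  nonneg : ∀ (ι : Type) [Fintype ι] (x : Matrix ι ι X), 0 ≤ ν ι x
  smul : ∀ (ι : Type) [Fintype ι] (c : ℂ) (x : Matrix ι ι X), ν ι (c • x) = ‖c‖ * ν ι x
  norm_entry_le : ∀ (ι : Type) [Fintype ι] (x : Matrix ι ι X) (i j : ι), ‖x i j‖ ≤ ν ι x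
  le_card_mul : ∀ (ι : Type) [Fintype ι] (x : Matrix ι ι X) (M : ℝ), 0 ≤ M →
    (∀ i j, ‖x i j‖ ≤ M) → ν ι x ≤ Fintype.card ι * M
  smul_const_le : ∀ (ι : Type) [Fintype ι] [DecidableEq ι] (A : Matrix ι ι ℝ) (c : ℝ), 0 ≤ c →
    (∀ j k, ∑ i, A i j * A i k = if j = k then c ^ 2 else 0) → ∀ h : X,
    ν ι (Matrix.of fun i j => (A i j : ℂ) • h) ≤ c * ‖h‖

theorem isMatrixNorm_opNorm' {H : Type*} [NormedAddCommGroup H] [InnerProductSpace ℂ H]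
    (X : Submodule ℂ (H →L[ℂ] H)) : IsMatrixNorm (X := X) fun _ _ x => opNorm' x where
  nonneg _ _ x := opNorm'_nonneg x
  smul _ _ c x := opNorm'_smul c x
  norm_entry_le _ _ x i j := norm_entry_le_opNorm' x i j
  le_card_mul _ _ x _ hM h := opNorm'_le_card_mul x hM h
  smul_const_le _ _ _ A _ hc hA h := opNorm'_smul_const_le A hc hA h

section Bounds

variable {X E : Type*} [AddCommGroup X] [NormedAddCommGroup E] [InnerProductSpace ℂ E]

/-- The amplifications of `F n` to matrices of size at most `n` in the `n`-ball map points at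
distance at most `r` to points at distance at most `s`. -/
def AmplifiedUpperBound (ν : ∀ (ι : Type) [Fintype ι], Matrix ι ι X → ℝ) (F : ℕ → X → E)
    (r s : ℝ) : Prop :=
  ∀ (ι : Type) [Fintype ι] [DecidableEq ι] (n : ℕ), 1 ≤ n → Fintype.card ι ≤ n →
    ∀ x z : Matrix ι ι X, ν ι x ≤ n → ν ι z ≤ n → ν ι (x - z) ≤ r →
      gramNorm (x.map (F n) - z.map (F n)) ≤ s

/-- The amplifications of `F n` to matrices of size at most `n` in the `n`-ball map points at
distance at least `r` to points at distance at least `s`. -/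
def AmplifiedLowerBound (ν : ∀ (ι : Type) [Fintype ι], Matrix ι ι X → ℝ) (F : ℕ → X → E)
    (r s : ℝ) : Prop :=
  ∀ (ι : Type) [Fintype ι] [DecidableEq ι] (n : ℕ), 1 ≤ n → Fintype.card ι ≤ n →
    ∀ x z : Matrix ι ι X, ν ι x ≤ n → ν ι z ≤ n → r ≤ ν ι (x - z) →
      s ≤ gramNorm (x.map (F n) - z.map (F n))

end Bounds

theorem exists_matrix_extend {ι κ α : Type*} {e : ι → κ} (he : Function.Injective e)
    (x : Matrix ι ι α) (a₀ : α) : ∃ y : Matrix κ κ α, (∀ i j, y (e i) (e j) = x i j) ∧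
      ∀ a b, a ∉ Set.range e ∨ b ∉ Set.range e → y a b = a₀ := by
  refine ⟨fun a b => Function.extend (Prod.map e e) (fun p : ι × ι => x p.1 p.2) (fun _ => a₀) (a, b),
    fun i j => ?_, fun a b h => ?_⟩
  · exact (he.prodMap he).extend_apply (fun p : ι × ι => x p.1 p.2) _ (i, j)
  · refine Function.extend_apply' _ _ _ ?_
    rintro ⟨⟨i, j⟩, hij⟩
    simp only [Prod.map_apply, Prod.mk.injEq] at hij
    rcases h with h | h
    · exact h ⟨i, hij.1⟩
    · exact h ⟨j, hij.2⟩

theorem BoundedSubsetsAlmostCompletelyCoarselyEmbed.exists_amplified_bounds {H J : Type*}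
    [NormedAddCommGroup H] [InnerProductSpace ℂ H] {X : Submodule ℂ (H →L[ℂ] H)}
    (h : BoundedSubsetsAlmostCompletelyCoarselyEmbed X (OH J)) :
    ∃ F : ℕ → X → OH J, (∀ r, 0 < r → ∃ s, 0 < s ∧ AmplifiedUpperBound (fun _ _ x => opNorm' x) F r s) ∧
      ∀ s, 0 < s → ∃ r, 0 < r ∧ AmplifiedLowerBound (fun _ _ x => opNorm' x) F r s := by
  classical
  obtain ⟨f, hup, hlow⟩ := h
  set F : ℕ → X → OH J := fun n x =>
    if hx : x ∈ Metric.closedBall (0 : X) (n : ℝ) then f n ⟨x, hx⟩ else 0 with hF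
  have hFf : ∀ n (a : Ball X n), F n a = f n a := fun n a => by
    simp only [hF]
    rw [dif_pos a.2]
  have key : ∀ (ι : Type) [Fintype ι] [DecidableEq ι] (n : ℕ), Fintype.card ι ≤ n →
      ∀ x z : Matrix ι ι X, opNorm' x ≤ n → opNorm' z ≤ n →
      ∃ x' z' : Matrix (Fin n) (Fin n) (Ball X n), matNorm n (toMat x') = opNorm' x ∧
        matNorm n (toMat z') = opNorm' z ∧ matNorm n (toMat x' - toMat z') = opNorm' (x - z) ∧
        matNorm n (x'.map (f n) - z'.map (f n)) = gramNorm (x.map (F n) - z.map (F n)) := by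
    intro ι _ _ n hn x z hx hz
    obtain ⟨e⟩ : Nonempty (ι ↪ Fin n) :=
      Function.Embedding.nonempty_of_card_le (by simpa using hn)
    have hball : ∀ w : Matrix ι ι X, opNorm' w ≤ n → ∀ i j,
        w i j ∈ Metric.closedBall (0 : X) (n : ℝ) := fun w hw i j =>
      mem_closedBall_zero_iff.2 ((norm_entry_le_opNorm' w i j).trans hw)
    have h0 : (0 : X) ∈ Metric.closedBall (0 : X) (n : ℝ) :=
      Metric.mem_closedBall_self (Nat.cast_nonneg n)
    obtain ⟨x', hx1, hx2⟩ := exists_matrix_extend e.injective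
      (Matrix.of fun i j => (⟨x i j, hball x hx i j⟩ : Ball X n)) ⟨0, h0⟩
    obtain ⟨z', hz1, hz2⟩ := exists_matrix_extend e.injective
      (Matrix.of fun i j => (⟨z i j, hball z hz i j⟩ : Ball X n)) ⟨0, h0⟩
    refine ⟨x', z', ?_, ?_, ?_, ?_⟩
    · rw [matNorm_eq_opNorm']
      exact opNorm'_extend e.injective (fun i j => by simp [toMat, hx1])
        (fun a b hab => by simp [toMat, hx2 a b hab])
    · rw [matNorm_eq_opNorm']
      exact opNorm'_extend e.injective (fun i j => by simp [toMat, hz1])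
        (fun a b hab => by simp [toMat, hz2 a b hab])
    · rw [matNorm_eq_opNorm']
      exact opNorm'_extend e.injective (fun i j => by simp [toMat, hx1, hz1])
        (fun a b hab => by simp [toMat, hx2 a b hab, hz2 a b hab])
    · rw [matNorm_eq_gramNorm]
      refine gramNorm_extend e.injective (fun i j => ?_)
        (fun a b hab => by simp [hx2 a b hab, hz2 a b hab])
      simp only [Matrix.sub_apply, Matrix.map_apply, hx1, hz1, ← hFf, Matrix.of_apply]
  refine ⟨F, fun r hr => ?_, fun s hs => ?_⟩
  · obtain ⟨s, hs, h⟩ := hup r hr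
    refine ⟨s, hs, fun ι _ _ n hn hcard x z hx hz hxz => ?_⟩
    obtain ⟨x', z', h1, h2, h3, h4⟩ := key ι n hcard x z hx hz
    rw [← h4]
    exact h n hn x' z' (h1.trans_le hx) (h2.trans_le hz) (h3.trans_le hxz)
  · obtain ⟨r, hr, h⟩ := hlow s hs
    refine ⟨r, hr, fun ι _ _ n hn hcard x z hx hz hxz => ?_⟩
    obtain ⟨x', z', h1, h2, h3, h4⟩ := key ι n hcard x z hx hz
    rw [← h4]
    exact h n hn x' z' (h1.trans_le hx) (h2.trans_le hz) (hxz.trans_eq h3.symm)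

section Coarse

variable {X E : Type*} [NormedAddCommGroup X] [NormedSpace ℂ X] [NormedAddCommGroup E]
  [InnerProductSpace ℂ E] {ν : ∀ (ι : Type) [Fintype ι], Matrix ι ι X → ℝ}

theorem IsMatrixNorm.unit (hν : IsMatrixNorm ν) (x : X) :
    ν Unit (Matrix.of fun _ _ : Unit => x) = ‖x‖ := by
  have h := hν.le_card_mul _ (Matrix.of fun _ _ : Unit => x) _ (norm_nonneg x) fun _ _ => le_rfl
  rw [Fintype.card_unit, Nat.cast_one, one_mul] at h
  exact le_antisymm h (hν.norm_entry_le _ (Matrix.of fun _ _ : Unit => x) () ())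

theorem gramNorm_unit (y : E) : gramNorm (Matrix.of fun _ _ : Unit => y) = ‖y‖ := by
  refine le_antisymm ?_ (by simpa using norm_sum_entries_le (Matrix.of fun _ _ : Unit => y))
  rw [gramNorm]
  refine Real.sqrt_le_iff.2 ⟨norm_nonneg y, ?_⟩
  rw [kerNorm_le_iff _ (sq_nonneg _)]
  intro v
  simp [gram, mul_pow, Fintype.sum_prod_type]

theorem AmplifiedUpperBound.norm_image_sub_le {F : ℕ → X → E} {r s : ℝ} (hν : IsMatrixNorm ν)
    (h : AmplifiedUpperBound ν F r s)
    {n : ℕ} (hn : 1 ≤ n) {x z : X} (hx : ‖x‖ ≤ n) (hz : ‖z‖ ≤ n) (hxz : ‖x - z‖ ≤ r) :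
    ‖F n x - F n z‖ ≤ s := by
  have := h Unit n hn (by simpa using hn) (Matrix.of fun _ _ => x) (Matrix.of fun _ _ => z)
    ((hν.unit x).trans_le hx) ((hν.unit z).trans_le hz)
    ((hν.unit (x - z)).trans_le hxz)
  exact (gramNorm_unit (F n x - F n z)).symm.trans_le this

theorem AmplifiedLowerBound.le_norm_image_sub {F : ℕ → X → E} {r s : ℝ} (hν : IsMatrixNorm ν)
    (h : AmplifiedLowerBound ν F r s)
    {n : ℕ} (hn : 1 ≤ n) {x z : X} (hx : ‖x‖ ≤ n) (hz : ‖z‖ ≤ n) (hxz : r ≤ ‖x - z‖) :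
    s ≤ ‖F n x - F n z‖ := by
  have := h Unit n hn (by simpa using hn) (Matrix.of fun _ _ => x) (Matrix.of fun _ _ => z)
    ((hν.unit x).trans_le hx) ((hν.unit z).trans_le hz)
    (hxz.trans_eq (hν.unit (x - z)).symm)
  exact this.trans_eq (gramNorm_unit (F n x - F n z))

/-- The even part of `F n` around `x` varies by at most `4 s / 4 ^ k` on steps of size `2 ^ (-k)`. -/
theorem AmplifiedUpperBound.norm_even_part_sub_le {F : ℕ → X → E} {s : ℝ}
    (hν : IsMatrixNorm ν)
    (h : AmplifiedUpperBound ν F 1 s) {k K n : ℕ} (hn : 1 ≤ n) (hnk : 4 ^ k * (2 * K) ≤ n)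
    (hK : 1 ≤ K) {x y y' : X} (hx : ‖x‖ ≤ K) (hy : ‖y‖ ≤ K) (hy' : ‖y'‖ ≤ K)
    (hyy : 2 ^ k * ‖y' - y‖ ≤ 1) :
    ‖(F n (x + y') + F n (x - y')) - (F n (x + y) + F n (x - y))‖ ≤ 4 * s / 4 ^ k := by
  set A := sylvester (2 * k) with hA
  set m : ℝ := 4 ^ k with hm
  have hm1 : 1 ≤ m := one_le_pow₀ (by norm_num)
  have hcard : Fintype.card (Fin (2 * k) → Bool) = 4 ^ k := by
    simp [pow_mul]
  have hnR : m * (2 * K) ≤ n := by rw [hm]; exact_mod_cast hnk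
  have hKR : (1 : ℝ) ≤ K := by exact_mod_cast hK
  have hnorm : ∀ a b : X, ‖a‖ ≤ K → ‖b‖ ≤ K →
      ν _ (Matrix.of fun i j => a + (A i j : ℂ) • b) ≤ n := by
    intro a b ha hb
    refine le_trans (hν.le_card_mul _ _ (2 * K) (by positivity) fun i j => ?_) ?_
    · rw [Matrix.of_apply]
      refine (norm_add_le _ _).trans ?_
      rw [norm_smul]
      rcases sylvester_eq_one_or (2 * k) i j with h | h <;> simp [hA, h] <;> linarith
    · rw [hcard]; push_cast; exact hnR
  set p := F n (x + y') - F n (x + y) with hp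
  set q := F n (x - y') - F n (x - y) with hq
  have hsmall : ‖y' - y‖ ≤ 1 := by
    refine le_trans ?_ hyy
    exact le_mul_of_one_le_left (norm_nonneg _) (one_le_pow₀ (by norm_num))
  have hball : ∀ a b : X, ‖a‖ ≤ K → ‖b‖ ≤ K → ‖a + b‖ ≤ n ∧ ‖a - b‖ ≤ n := by
    intro a b ha hb
    have h2 : (2 * K : ℝ) ≤ n := le_trans (le_mul_of_one_le_left (by positivity) hm1) hnR
    exact ⟨(norm_add_le _ _).trans (by linarith), (_root_.norm_sub_le _ _).trans (by linarith)⟩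
  have hpn : ‖p‖ ≤ s := h.norm_image_sub_le hν hn (hball x y' hx hy').1 (hball x y hx hy).1
    (by rwa [add_sub_add_left_eq_sub])
  have hqn : ‖q‖ ≤ s := h.norm_image_sub_le hν hn (hball x y' hx hy').2 (hball x y hx hy).2
    (by rwa [sub_sub_sub_cancel_left, norm_sub_rev])
  have hmain := h (Fin (2 * k) → Bool) n hn (by
      rw [hcard]; exact le_trans (Nat.le_mul_of_pos_right _ (by omega)) hnk)
    (Matrix.of fun i j => x + (A i j : ℂ) • y') (Matrix.of fun i j => x + (A i j : ℂ) • y)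
    (hnorm _ _ hx hy') (hnorm _ _ hx hy) (by
      have h1 := hν.smul_const_le _ A (2 ^ k) (by positivity) (fun i j => by
        rw [hA, sylvester_columns, ← pow_mul, mul_comm k]) (y' - y)
      refine le_trans (le_of_eq ?_) (h1.trans hyy)
      congr 1
      ext1 i j
      simp only [Matrix.sub_apply, Matrix.of_apply, smul_sub]
      abel)
  have hentry : ∀ i j, ((Matrix.of fun i j => x + (A i j : ℂ) • y').map (F n) -
      (Matrix.of fun i j => x + (A i j : ℂ) • y).map (F n)) i j =
      (1 / 2 : ℂ) • (p + q) + (A i j : ℂ) • ((1 / 2 : ℂ) • (p - q)) := by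
    intro i j
    simp only [Matrix.sub_apply, Matrix.map_apply, Matrix.of_apply]
    rcases sylvester_eq_one_or (2 * k) i j with h | h <;> rw [← hA] at h <;> rw [h]
    · simp only [Complex.ofReal_one, one_smul, ← hp]
      module
    · simp only [Complex.ofReal_neg, Complex.ofReal_one, neg_smul, one_smul, ← sub_eq_add_neg]
      module
  have hsum := norm_sum_entries_le ((Matrix.of fun i j => x + (A i j : ℂ) • y').map (F n) -
      (Matrix.of fun i j => x + (A i j : ℂ) • y).map (F n))
  have hsumA : ∑ i, ∑ j, (A i j : ℂ) = (m : ℂ) := by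
    have := sum_sylvester (2 * k)
    rw [pow_mul] at this
    norm_num at this
    rw [hm, ← this]
    push_cast
    rfl
  have htot : ∑ i, ∑ j, ((Matrix.of fun i j => x + (A i j : ℂ) • y').map (F n) -
      (Matrix.of fun i j => x + (A i j : ℂ) • y).map (F n)) i j =
      (m ^ 2 / 2 : ℂ) • (p + q) + (m / 2 : ℂ) • (p - q) := by
    simp only [hentry, Finset.sum_add_distrib, ← Finset.sum_smul, hsumA, Finset.sum_const,
      Finset.card_univ, hcard, ← Nat.cast_smul_eq_nsmul ℂ]
    rw [hm]
    push_cast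
    module
  rw [htot, hcard] at hsum
  push_cast at hsum
  rw [← hm] at hsum
  have e1 : ‖(m ^ 2 / 2 : ℂ) • (p + q)‖ = m ^ 2 / 2 * ‖p + q‖ := by
    rw [norm_smul]
    congr 1
    rw [show (m ^ 2 / 2 : ℂ) = ((m ^ 2 / 2 : ℝ) : ℂ) by push_cast; rfl, Complex.norm_real,
      Real.norm_of_nonneg (by positivity)]
  have e2 : ‖(m / 2 : ℂ) • (p - q)‖ ≤ m / 2 * (s + s) := by
    rw [norm_smul, show (m / 2 : ℂ) = ((m / 2 : ℝ) : ℂ) by push_cast; rfl, Complex.norm_real,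
      Real.norm_of_nonneg (by positivity)]
    gcongr
    exact (_root_.norm_sub_le _ _).trans (add_le_add hpn hqn)
  have e3 : m ^ 2 / 2 * ‖p + q‖ ≤ m * s + m / 2 * (s + s) := by
    rw [← e1]
    have := norm_sub_le ((m ^ 2 / 2 : ℂ) • (p + q) + (m / 2 : ℂ) • (p - q)) ((m / 2 : ℂ) • (p - q))
    rw [add_sub_cancel_right] at this
    have h5 : m * gramNorm ((Matrix.of fun i j => x + (A i j : ℂ) • y').map (F n) -
      (Matrix.of fun i j => x + (A i j : ℂ) • y).map (F n)) ≤ m * s := by gcongr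
    linarith
  have e4 : (F n (x + y') + F n (x - y')) - (F n (x + y) + F n (x - y)) = p + q := by
    rw [hp, hq]; abel
  rw [e4, le_div_iff₀ (by positivity)]
  refine le_of_mul_le_mul_left ?_ (show 0 < m / 2 by positivity)
  nlinarith

theorem AmplifiedUpperBound.norm_second_difference_le {F : ℕ → X → E} {s : ℝ}
    (hν : IsMatrixNorm ν)
    (h : AmplifiedUpperBound ν F 1 s) {k K n : ℕ} (hn : 1 ≤ n) (hnk : 4 ^ k * (2 * K) ≤ n)
    (hK : 1 ≤ K) {x y : X} (hx : ‖x‖ ≤ K) (hy : ‖y‖ ≤ K) :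
    ‖F n (x + y) + F n (x - y) - (F n x + F n x)‖ ≤ 4 * s * K / 2 ^ k := by
  set N : ℕ := K * 2 ^ k with hN
  have hN0 : (0 : ℝ) < N := by rw [hN]; positivity
  set e : ℕ → E := fun j =>
    F n (x + ((j / N : ℝ) : ℂ) • y) + F n (x - ((j / N : ℝ) : ℂ) • y) with he
  have hball : ∀ j, j ≤ N → ‖((j / N : ℝ) : ℂ) • y‖ ≤ K := by
    intro j hj
    rw [norm_smul, Complex.norm_real, Real.norm_of_nonneg (by positivity)]
    refine le_trans (mul_le_of_le_one_left (norm_nonneg y) ?_) hy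
    rw [div_le_one hN0]
    exact_mod_cast hj
  have hstep : ∀ j, j < N → dist (e j) (e (j + 1)) ≤ 4 * s / 4 ^ k := by
    intro j hj
    rw [dist_comm, dist_eq_norm]
    refine h.norm_even_part_sub_le hν hn hnk hK hx (hball j hj.le) (hball (j + 1) hj) ?_
    rw [← sub_smul, norm_smul, ← Complex.ofReal_sub, Complex.norm_real]
    have : ((j + 1 : ℕ) / N - j / N : ℝ) = 1 / N := by push_cast; ring
    rw [this, Real.norm_of_nonneg (by positivity), hN]
    push_cast
    have hK0 : (0 : ℝ) < K := by exact_mod_cast hK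
    rw [one_div, mul_inv]
    calc (2 : ℝ) ^ k * ((K : ℝ)⁻¹ * (2 ^ k)⁻¹ * ‖y‖) = ‖y‖ / K := by field_simp
      _ ≤ 1 := by rwa [div_le_one hK0]
  have hsum := dist_le_range_sum_of_dist_le (f := e) (d := fun _ => 4 * s / 4 ^ k) N
    (fun {j} hj => hstep j hj)
  rw [dist_comm, dist_eq_norm, Finset.sum_const, Finset.card_range, nsmul_eq_mul] at hsum
  have h1 : e N = F n (x + y) + F n (x - y) := by
    simp only [he, div_self hN0.ne', Complex.ofReal_one, one_smul]
  have h0 : e 0 = F n x + F n x := by simp [he]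
  rw [h1, h0] at hsum
  refine hsum.trans_eq ?_
  rw [hN, show (4 : ℝ) ^ k = 2 ^ k * 2 ^ k by rw [← mul_pow]; norm_num]
  push_cast
  field_simp

theorem AmplifiedUpperBound.tendsto_second_difference {F : ℕ → X → E} {s : ℝ}
    (hν : IsMatrixNorm ν)
    (h : AmplifiedUpperBound ν F 1 s) (x y : X) :
    Tendsto (fun n => F n (x + y) + F n (x - y) - (F n x + F n x)) atTop (𝓝 0) := by
  obtain ⟨K, hK⟩ := exists_nat_ge (max 1 (max ‖x‖ ‖y‖))
  simp only [max_le_iff] at hK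
  obtain ⟨hK1, hx, hy⟩ := hK
  have hK1' : 1 ≤ K := by exact_mod_cast hK1
  rw [Metric.tendsto_atTop]
  intro ε hε
  have hlim : Tendsto (fun k : ℕ => 4 * s * K / 2 ^ k) atTop (𝓝 0) :=
    tendsto_const_nhds.div_atTop (tendsto_pow_atTop_atTop_of_one_lt (by norm_num))
  obtain ⟨k, hk⟩ := (hlim.eventually (gt_mem_nhds hε)).exists
  refine ⟨max 1 (4 ^ k * (2 * K)), fun n hn => ?_⟩
  rw [dist_zero_right]
  exact (h.norm_second_difference_le hν ((le_max_left _ _).trans hn) ((le_max_right _ _).trans hn)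
    hK1' hx hy).trans_lt hk

/-- The maps `F n - F n 0` are asymptotically additive. -/
theorem AmplifiedUpperBound.tendsto_additive_defect {F : ℕ → X → E} {s : ℝ}
    (hν : IsMatrixNorm ν)
    (h : AmplifiedUpperBound ν F 1 s) (a b : X) :
    Tendsto (fun n => (F n (a + b) - F n 0) - ((F n a - F n 0) + (F n b - F n 0))) atTop
      (𝓝 0) := by
  set c : X := (1 / 2 : ℂ) • (a + b) with hc
  have h1 := h.tendsto_second_difference hν c c
  have h2 := h.tendsto_second_difference hν c ((1 / 2 : ℂ) • (a - b))
  have e1 : c + c = a + b := by rw [hc]; module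
  have e2 : c + (1 / 2 : ℂ) • (a - b) = a := by rw [hc]; module
  have e3 : c - (1 / 2 : ℂ) • (a - b) = b := by rw [hc]; module
  rw [e1, sub_self] at h1
  rw [e2, e3] at h2
  have h3 := h1.sub h2
  rw [sub_zero] at h3
  refine h3.congr fun n => ?_
  abel

end Coarse

/-! ### Linearization -/

section Linearization

theorem tendsto_inner_zero_of_bounded {α E : Type*} {l : Filter α} [NormedAddCommGroup E]
    [InnerProductSpace ℂ E] {u v : α → E} {M : ℝ} (hu : ∀ᶠ a in l, ‖u a‖ ≤ M)
    (hv : Tendsto v l (𝓝 0)) : Tendsto (fun a => inner ℂ (u a) (v a)) l (𝓝 0) := by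
  refine squeeze_zero_norm' (a := fun a => M * ‖v a‖) ?_ (by simpa using hv.norm.const_mul M)
  filter_upwards [hu] with a ha
  exact (norm_inner_le_norm _ _).trans (mul_le_mul_of_nonneg_right ha (norm_nonneg _))

theorem tendsto_inner_zero_of_bounded' {α E : Type*} {l : Filter α} [NormedAddCommGroup E]
    [InnerProductSpace ℂ E] {u v : α → E} {M : ℝ} (hu : ∀ᶠ a in l, ‖u a‖ ≤ M)
    (hv : Tendsto v l (𝓝 0)) : Tendsto (fun a => inner ℂ (v a) (u a)) l (𝓝 0) := by
  have h := (Complex.continuous_conj.tendsto 0).comp (tendsto_inner_zero_of_bounded hu hv)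
  rw [map_zero] at h
  exact h.congr fun a => inner_conj_symm _ _

theorem exists_tendsto_of_bounded {α : Type*} (U : Ultrafilter α) {f : α → ℂ} {M : ℝ}
    (h : ∀ᶠ a in U, ‖f a‖ ≤ M) : ∃ b, Tendsto f U (𝓝 b) := by
  obtain ⟨b, -, hb⟩ := (isCompact_closedBall (0 : ℂ) M).ultrafilter_le_nhds (U.map f) (by
    rw [le_principal_iff]
    exact h.mono fun a ha => mem_closedBall_zero_iff.2 ha)
  exact ⟨b, hb⟩

theorem map_complex_smul_of_bounded {X : Type*} [NormedAddCommGroup X] [NormedSpace ℂ X]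
    (φ : X →+ ℂ) {M : ℝ} (hM : ∀ x, ‖x‖ ≤ 1 → ‖φ x‖ ≤ M)
    (hI : ∀ x, φ (Complex.I • x) = Complex.I * φ x) (c : ℂ) (x : X) : φ (c • x) = c * φ x := by
  let _ : NormedSpace ℝ X := NormedSpace.restrictScalars ℝ ℂ X
  have hcont : Continuous φ := by
    refine φ.continuous_of_isBounded_nhds_zero (Metric.closedBall_mem_nhds (0 : X) one_pos) ?_
    refine (Metric.isBounded_closedBall (x := (0 : ℂ)) (r := M)).subset ?_
    rintro _ ⟨x, hx, rfl⟩
    exact mem_closedBall_zero_iff.2 (hM x (mem_closedBall_zero_iff.1 hx))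
  have hreal : ∀ (a : ℝ) (x : X), φ ((a : ℂ) • x) = a * φ x := fun a x => by
    have := map_real_smul φ hcont a x
    rw [Complex.real_smul] at this
    exact this
  conv_lhs => rw [← Complex.re_add_im c]
  rw [add_smul, map_add, mul_smul, hreal, hreal, hI]
  conv_rhs => rw [← Complex.re_add_im c]
  ring

variable {X E : Type*} [NormedAddCommGroup X] [NormedSpace ℂ X] [NormedAddCommGroup E]
  [InnerProductSpace ℂ E]

/-- The complex-linear part of a map. -/
def linPart (G : X → E) (x : X) : E := (1 / 2 : ℂ) • (G x - Complex.I • G (Complex.I • x))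

/-- The conjugate-linear part of a map. -/
def antiPart (G : X → E) (x : X) : E := (1 / 2 : ℂ) • (G x + Complex.I • G (Complex.I • x))

theorem linPart_add_antiPart (G : X → E) (x : X) : linPart G x + antiPart G x = G x := by
  rw [linPart, antiPart]
  module

theorem norm_linPart_le {G : X → E} {x : X} {s : ℝ} (h : ‖G x‖ ≤ s)
    (h' : ‖G (Complex.I • x)‖ ≤ s) : ‖linPart G x‖ ≤ s := by
  rw [linPart, norm_smul]
  have := norm_sub_le (G x) (Complex.I • G (Complex.I • x))
  rw [norm_smul, Complex.norm_I, one_mul] at this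
  norm_num
  linarith

theorem norm_antiPart_le {G : X → E} {x : X} {s : ℝ} (h : ‖G x‖ ≤ s)
    (h' : ‖G (Complex.I • x)‖ ≤ s) : ‖antiPart G x‖ ≤ s := by
  rw [antiPart, norm_smul]
  have := norm_add_le (G x) (Complex.I • G (Complex.I • x))
  rw [norm_smul, Complex.norm_I, one_mul] at this
  norm_num
  linarith

/-- A sesquilinear expression combining the complex-linear and the conjugate-linear part of a
map. -/
def sesqForm (G : X → E) (x y : X) : ℂ :=
  inner ℂ (linPart G x) (linPart G y) + inner ℂ (antiPart G y) (antiPart G x)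

theorem conj_sesqForm (G : X → E) (x y : X) : conj (sesqForm G x y) = sesqForm G y x := by
  simp [sesqForm]

/-- The Gram matrix of a matrix with respect to a form. -/
def formGram {ι : Type*} (B : X → X → ℂ) (x : Matrix ι ι X) : Matrix (ι × ι) (ι × ι) ℂ :=
  Matrix.of fun p q => B (x p.2 q.2) (x p.1 q.1)

theorem formGram_sesqForm {ι : Type*} (G : X → E) (x : Matrix ι ι X) :
    formGram (sesqForm G) x = gram (x.map (linPart G)) +
      (gram (x.map (antiPart G))).submatrix Prod.swap Prod.swap := by
  ext p q
  simp [formGram, sesqForm, gram]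

section

variable {ι : Type*} [Fintype ι] [DecidableEq ι]

theorem kerNorm_gram_linPart_le (G : X → E) (x : Matrix ι ι X) :
    kerNorm (gram (x.map (linPart G))) ≤
      (kerNorm (gram (x.map G)) + kerNorm (gram ((Complex.I • x).map G))) / 2 := by
  have h := kerNorm_gram_add_le ((1 / 2 : ℂ) • x.map G)
    ((-(1 / 2) * Complex.I : ℂ) • (Complex.I • x).map G)
  have e : (1 / 2 : ℂ) • x.map G + (-(1 / 2) * Complex.I : ℂ) • (Complex.I • x).map G =
      x.map (linPart G) := by
    ext1 i j
    simp only [Matrix.add_apply, Matrix.smul_apply, Matrix.map_apply, linPart]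
    module
  rw [e, gram_smul, gram_smul, kerNorm_smul, kerNorm_smul] at h
  refine h.trans_eq ?_
  simp
  ring

theorem kerNorm_gram_antiPart_le (G : X → E) (x : Matrix ι ι X) :
    kerNorm (gram (x.map (antiPart G))) ≤
      (kerNorm (gram (x.map G)) + kerNorm (gram ((Complex.I • x).map G))) / 2 := by
  have h := kerNorm_gram_add_le ((1 / 2 : ℂ) • x.map G)
    ((1 / 2 * Complex.I : ℂ) • (Complex.I • x).map G)
  have e : (1 / 2 : ℂ) • x.map G + (1 / 2 * Complex.I : ℂ) • (Complex.I • x).map G =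
      x.map (antiPart G) := by
    ext1 i j
    simp only [Matrix.add_apply, Matrix.smul_apply, Matrix.map_apply, antiPart]
    module
  rw [e, gram_smul, gram_smul, kerNorm_smul, kerNorm_smul] at h
  refine h.trans_eq ?_
  simp
  ring

theorem kerNorm_formGram_sesqForm_le (G : X → E) (x : Matrix ι ι X) :
    kerNorm (formGram (sesqForm G) x) ≤
      kerNorm (gram (x.map G)) + kerNorm (gram ((Complex.I • x).map G)) := by
  rw [formGram_sesqForm]
  refine (kerNorm_add_le _ _).trans ?_
  rw [kerNorm_swap]
  have := kerNorm_gram_linPart_le G x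
  have := kerNorm_gram_antiPart_le G x
  linarith

theorem kerNorm_gram_le_formGram_sesqForm (G : X → E) (x : Matrix ι ι X) :
    kerNorm (gram (x.map G)) ≤ 4 * kerNorm (formGram (sesqForm G) x) := by
  have h := kerNorm_gram_add_le (x.map (linPart G)) (x.map (antiPart G))
  have e : x.map (linPart G) + x.map (antiPart G) = x.map G := by
    ext1 i j
    exact linPart_add_antiPart G _
  rw [e] at h
  have h1 := (posKer_gram (x.map (linPart G))).kerNorm_le_add (posKer_gram (x.map (antiPart G))).swap
  have h2 := (posKer_gram (x.map (antiPart G))).swap.kerNorm_le_add (posKer_gram (x.map (linPart G)))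
  rw [kerNorm_swap, add_comm] at h2
  rw [formGram_sesqForm]
  linarith

end

variable {ν : ∀ (ι : Type) [Fintype ι], Matrix ι ι X → ℝ}

theorem IsMatrixNorm.zero (hν : IsMatrixNorm ν) (ι : Type) [Fintype ι] :
    ν ι (0 : Matrix ι ι X) = 0 := by
  simpa using hν.smul ι 0 0

theorem AmplifiedUpperBound.gramNorm_map_le (hν : IsMatrixNorm ν) {F : ℕ → X → E} {r s : ℝ}
    (h : AmplifiedUpperBound ν F r s) {ι : Type} [Fintype ι] [DecidableEq ι] {x : Matrix ι ι X}
    (hx : ν ι x ≤ r) : ∀ᶠ n in atTop, gramNorm (x.map fun a => F n a - F n 0) ≤ s := by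
  filter_upwards [eventually_ge_atTop 1, eventually_ge_atTop (Fintype.card ι),
    tendsto_natCast_atTop_atTop.eventually_ge_atTop (ν ι x)] with n h1 h2 h3
  exact h ι n h1 h2 x 0 h3 (by rw [hν.zero]; positivity) (by rwa [sub_zero])

theorem AmplifiedLowerBound.le_gramNorm_map (hν : IsMatrixNorm ν) {F : ℕ → X → E} {r s : ℝ}
    (h : AmplifiedLowerBound ν F r s) {ι : Type} [Fintype ι] [DecidableEq ι] {x : Matrix ι ι X}
    (hx : r ≤ ν ι x) : ∀ᶠ n in atTop, s ≤ gramNorm (x.map fun a => F n a - F n 0) := by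
  filter_upwards [eventually_ge_atTop 1, eventually_ge_atTop (Fintype.card ι),
    tendsto_natCast_atTop_atTop.eventually_ge_atTop (ν ι x)] with n h1 h2 h3
  exact h ι n h1 h2 x 0 h3 (by rw [hν.zero]; positivity) (by rwa [sub_zero])

/-- Maps with amplified coarse bounds yield a Hilbertian form on `X` whose operator Hilbert space
norms are equivalent to the matrix norms of `X`. -/
theorem exists_form (hν : IsMatrixNorm ν) {F : ℕ → X → E}
    (hup : ∀ r, 0 < r → ∃ s, 0 < s ∧ AmplifiedUpperBound ν F r s)
    (hlow : ∃ r, 0 < r ∧ AmplifiedLowerBound ν F r 1) :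
    ∃ (B : X → X → ℂ) (C : ℝ), 0 < C ∧ (∀ x y, conj (B x y) = B y x) ∧ (∀ x, 0 ≤ (B x x).re) ∧
      (∀ x y z, B x (y + z) = B x y + B x z) ∧ (∀ (c : ℂ) (x y : X), B x (c • y) = c * B x y) ∧
      ∀ (ι : Type) [Fintype ι] [DecidableEq ι] (x : Matrix ι ι X),
        kerNorm (formGram B x) ≤ C * ν ι x ^ 2 ∧ ν ι x ^ 2 ≤ C * kerNorm (formGram B x) := by
  set U : Ultrafilter ℕ := hyperfilter ℕ with hU
  have hUle : (U : Filter ℕ) ≤ atTop := Nat.hyperfilter_le_atTop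
  set G : ℕ → X → E := fun n x => F n x - F n 0 with hG
  obtain ⟨s, hs, hup1⟩ := hup 1 one_pos
  obtain ⟨r, hr, hlow⟩ := hlow
  -- boundedness
  have hGb : ∀ R : ℝ, 0 < R → ∃ s, 0 < s ∧ ∀ x : X, ‖x‖ ≤ R → ∀ᶠ n in atTop, ‖G n x‖ ≤ s := by
    intro R hR
    obtain ⟨s, hs, h⟩ := hup R hR
    refine ⟨s, hs, fun x hx => ?_⟩
    filter_upwards [eventually_ge_atTop 1, tendsto_natCast_atTop_atTop.eventually_ge_atTop R]
      with n h1 h2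
    exact h.norm_image_sub_le hν h1 (hx.trans h2) (by simp) (by simpa using hx)
  have hPb : ∀ R : ℝ, 0 < R → ∃ s, 0 < s ∧ ∀ x : X, ‖x‖ ≤ R → ∀ᶠ n in atTop,
      ‖linPart (G n) x‖ ≤ s ∧ ‖antiPart (G n) x‖ ≤ s := by
    intro R hR
    obtain ⟨s, hs, h⟩ := hGb R hR
    refine ⟨s, hs, fun x hx => ?_⟩
    filter_upwards [h x hx, h (Complex.I • x) (by rwa [norm_smul, Complex.norm_I, one_mul])]
      with n h1 h2
    exact ⟨norm_linPart_le h1 h2, norm_antiPart_le h1 h2⟩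
  have hSb : ∀ R : ℝ, 0 < R → ∃ M, ∀ x y : X, ‖x‖ ≤ R → ‖y‖ ≤ R → ∀ᶠ n in U,
      ‖sesqForm (G n) x y‖ ≤ M := by
    intro R hR
    obtain ⟨s, hs, h⟩ := hPb R hR
    refine ⟨s * s + s * s, fun x y hx hy => ?_⟩
    filter_upwards [hUle (h x hx), hUle (h y hy)] with n h1 h2
    refine (norm_add_le _ _).trans (add_le_add ?_ ?_)
    · exact (norm_inner_le_norm _ _).trans (mul_le_mul h1.1 h2.1 (norm_nonneg _) hs.le)
    · exact (norm_inner_le_norm _ _).trans (mul_le_mul h2.2 h1.2 (norm_nonneg _) hs.le)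
  have hPb' : ∀ x : X, ∃ s, (∀ᶠ n in U, ‖linPart (G n) x‖ ≤ s) ∧
      ∀ᶠ n in U, ‖antiPart (G n) x‖ ≤ s := by
    intro x
    obtain ⟨s, -, h⟩ := hPb (‖x‖ + 1) (by positivity)
    exact ⟨s, hUle ((h x (by linarith)).mono fun _ h => h.1),
      hUle ((h x (by linarith)).mono fun _ h => h.2)⟩
  have hlim : ∀ x y : X, ∃ b, Tendsto (fun n => sesqForm (G n) x y) U (𝓝 b) := by
    intro x y
    obtain ⟨M, hM⟩ := hSb (max ‖x‖ ‖y‖ + 1) (by positivity)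
    exact exists_tendsto_of_bounded U (hM x y ((le_max_left _ _).trans (by linarith))
      ((le_max_right _ _).trans (by linarith)))
  choose B hB using hlim
  -- asymptotic linearity
  have hGadd : ∀ a b : X, Tendsto (fun n => G n (a + b) - (G n a + G n b)) U (𝓝 0) := fun a b =>
    (hup1.tendsto_additive_defect hν a b).mono_left hUle
  have hGneg : ∀ a : X, Tendsto (fun n => G n (-a) + G n a) U (𝓝 0) := by
    intro a
    have := (hGadd (-a) a).neg
    rw [neg_zero] at this
    refine this.congr fun n => ?_
    simp [hG]
  have hladd : ∀ a b : X, Tendsto (fun n => linPart (G n) (a + b) -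
      (linPart (G n) a + linPart (G n) b)) U (𝓝 0) := by
    intro a b
    have h := ((hGadd a b).sub ((hGadd (Complex.I • a) (Complex.I • b)).const_smul
      Complex.I)).const_smul (1 / 2 : ℂ)
    rw [smul_zero, sub_zero, smul_zero] at h
    refine h.congr fun n => ?_
    simp only [linPart, smul_add]
    module
  have haadd : ∀ a b : X, Tendsto (fun n => antiPart (G n) (a + b) -
      (antiPart (G n) a + antiPart (G n) b)) U (𝓝 0) := by
    intro a b
    have h := ((hGadd a b).add ((hGadd (Complex.I • a) (Complex.I • b)).const_smul
      Complex.I)).const_smul (1 / 2 : ℂ)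
    rw [smul_zero, add_zero, smul_zero] at h
    refine h.congr fun n => ?_
    simp only [antiPart, smul_add]
    module
  have hII : ∀ a : X, Complex.I • Complex.I • a = -a := fun a => by
    rw [smul_smul, Complex.I_mul_I, neg_one_smul]
  have hIIE : ∀ a : E, Complex.I • Complex.I • a = -a := fun a => by
    rw [smul_smul, Complex.I_mul_I, neg_one_smul]
  have hlI : ∀ a : X, Tendsto (fun n => linPart (G n) (Complex.I • a) -
      Complex.I • linPart (G n) a) U (𝓝 0) := by
    intro a
    have h := (hGneg a).const_smul (-(1 / 2) * Complex.I : ℂ)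
    rw [smul_zero] at h
    refine h.congr fun n => ?_
    simp only [linPart, hII, smul_sub, smul_comm Complex.I (1 / 2 : ℂ), hIIE]
    module
  have haI : ∀ a : X, Tendsto (fun n => antiPart (G n) (Complex.I • a) +
      Complex.I • antiPart (G n) a) U (𝓝 0) := by
    intro a
    have h := (hGneg a).const_smul (1 / 2 * Complex.I : ℂ)
    rw [smul_zero] at h
    refine h.congr fun n => ?_
    simp only [antiPart, hII, smul_add, smul_comm Complex.I (1 / 2 : ℂ), hIIE]
    module
  have hBadd : ∀ x y z, B x (y + z) = B x y + B x z := by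
    intro x y z
    obtain ⟨M, hM1, hM2⟩ := hPb' x
    have h1 := (tendsto_inner_zero_of_bounded hM1 (hladd y z)).add
      (tendsto_inner_zero_of_bounded' hM2 (haadd y z))
    rw [add_zero] at h1
    have h2 := (hB x (y + z)).sub ((hB x y).add (hB x z))
    refine sub_eq_zero.1 (tendsto_nhds_unique (h2.congr fun n => ?_) h1)
    simp only [sesqForm, inner_sub_left, inner_sub_right, inner_add_left, inner_add_right]
    ring
  have hBI : ∀ x y, B x (Complex.I • y) = Complex.I * B x y := by
    intro x y
    obtain ⟨M, hM1, hM2⟩ := hPb' x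
    have h1 := (tendsto_inner_zero_of_bounded hM1 (hlI y)).add
      (tendsto_inner_zero_of_bounded' hM2 (haI y))
    rw [add_zero] at h1
    have h2 := (hB x (Complex.I • y)).sub ((hB x y).const_mul Complex.I)
    refine sub_eq_zero.1 (tendsto_nhds_unique (h2.congr fun n => ?_) h1)
    simp only [sesqForm, inner_sub_right, inner_add_left, inner_smul_left, inner_smul_right,
      Complex.conj_I]
    ring
  have hBconj : ∀ x y, conj (B x y) = B y x := by
    intro x y
    refine tendsto_nhds_unique ?_ (hB y x)
    exact ((Complex.continuous_conj.tendsto _).comp (hB x y)).congr fun n => conj_sesqForm _ _ _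
  have hBsmul : ∀ (c : ℂ) (x y : X), B x (c • y) = c * B x y := by
    intro c x y
    obtain ⟨M, hM⟩ := hSb (max ‖x‖ 1) (by positivity)
    refine map_complex_smul_of_bounded (AddMonoidHom.mk' (B x) (hBadd x)) (M := M) (fun y hy => ?_)
      (hBI x) c y
    exact le_of_tendsto (hB x y).norm (hM x y (le_max_left _ _) (hy.trans (le_max_right _ _)))
  have hBpos : ∀ x, 0 ≤ (B x x).re := by
    intro x
    refine ge_of_tendsto' ((Complex.continuous_re.tendsto _).comp (hB x x)) fun n => ?_
    simp only [Function.comp_apply, sesqForm, Complex.add_re]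
    exact add_nonneg (inner_self_nonneg (𝕜 := ℂ)) (inner_self_nonneg (𝕜 := ℂ))
  -- norm bounds
  have hgram : ∀ (ι : Type) [Fintype ι] [DecidableEq ι] (x : Matrix ι ι X),
      Tendsto (fun n => kerNorm (formGram (sesqForm (G n)) x)) U (𝓝 (kerNorm (formGram B x))) :=
    fun ι _ _ x => tendsto_kerNorm fun p q => hB _ _
  have hupper : ∀ (ι : Type) [Fintype ι] [DecidableEq ι] (x : Matrix ι ι X), ν ι x ≤ 1 →
      kerNorm (formGram B x) ≤ 2 * s ^ 2 := by
    intro ι _ _ x hx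
    refine le_of_tendsto (hgram ι x) ?_
    filter_upwards [hUle (hup1.gramNorm_map_le hν hx), hUle (hup1.gramNorm_map_le hν
      (x := Complex.I • x) (by rwa [hν.smul, Complex.norm_I, one_mul]))] with n h1 h2
    refine (kerNorm_formGram_sesqForm_le (G n) x).trans ?_
    rw [← gramNorm_sq, ← gramNorm_sq]
    have h3 := pow_le_pow_left₀ (gramNorm_nonneg _) h1 2
    have h4 := pow_le_pow_left₀ (gramNorm_nonneg _) h2 2
    linarith
  have hlower : ∀ (ι : Type) [Fintype ι] [DecidableEq ι] (x : Matrix ι ι X), r ≤ ν ι x →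
      1 ≤ 4 * kerNorm (formGram B x) := by
    intro ι _ _ x hx
    refine ge_of_tendsto ((hgram ι x).const_mul 4) ?_
    filter_upwards [hUle (hlow.le_gramNorm_map hν hx)] with n h1
    refine le_trans ?_ (kerNorm_gram_le_formGram_sesqForm (G n) x)
    rw [← gramNorm_sq]
    exact one_le_pow₀ h1
  have hscale : ∀ (ι : Type) [Fintype ι] [DecidableEq ι] (t : ℝ) (x : Matrix ι ι X),
      kerNorm (formGram B ((t : ℂ) • x)) = t ^ 2 * kerNorm (formGram B x) := by
    intro ι _ _ t x
    have e : formGram B ((t : ℂ) • x) = ((t ^ 2 : ℝ) : ℂ) • formGram B x := by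
      ext p q
      simp only [formGram, Matrix.of_apply, Matrix.smul_apply, smul_eq_mul]
      rw [hBsmul, ← hBconj, hBsmul, map_mul, Complex.conj_ofReal, hBconj]
      push_cast
      ring
    rw [e, kerNorm_smul, Complex.norm_real, Real.norm_of_nonneg (sq_nonneg t)]
  refine ⟨B, max (2 * s ^ 2) (4 * r ^ 2), by positivity, hBconj, hBpos, hBadd, hBsmul,
    fun ι _ _ x => ?_⟩
  rcases (hν.nonneg ι x).eq_or_lt with h0 | h0
  · have hx : x = 0 := by
      ext1 i j
      exact norm_le_zero_iff.1 ((hν.norm_entry_le ι x i j).trans_eq h0.symm)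
    have h1 := hscale ι 0 x
    rw [Complex.ofReal_zero, zero_smul] at h1
    rw [hx, h1, hν.zero]
    simp
  · constructor
    · have h1 := hupper ι ((((ν ι x)⁻¹ : ℝ) : ℂ) • x) (by
        rw [hν.smul, Complex.norm_real, Real.norm_of_nonneg (by positivity),
          inv_mul_cancel₀ h0.ne'])
      rw [hscale, inv_pow, inv_mul_le_iff₀ (by positivity), mul_comm] at h1
      exact h1.trans (mul_le_mul_of_nonneg_right (le_max_left _ _) (sq_nonneg _))
    · have h1 := hlower ι (((r * (ν ι x)⁻¹ : ℝ) : ℂ) • x) (by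
        rw [hν.smul, Complex.norm_real, Real.norm_of_nonneg (by positivity), mul_assoc,
          inv_mul_cancel₀ h0.ne', mul_one])
      rw [hscale, mul_pow, inv_pow] at h1
      refine le_trans ?_ (mul_le_mul_of_nonneg_right (le_max_right (2 * s ^ 2) (4 * r ^ 2))
        (kerNorm_nonneg _))
      have h2 := mul_le_mul_of_nonneg_left h1 (sq_nonneg (ν ι x))
      rw [mul_one] at h2
      refine h2.trans_eq ?_
      field_simp

end Linearization

/-! ### Hilbertian renormings -/

/-- A copy of a vector space, to be equipped with another norm. -/
def Renormed (X : Type*) : Type _ := X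

instance (X : Type*) [AddCommGroup X] : AddCommGroup (Renormed X) :=
  inferInstanceAs (AddCommGroup X)

instance (X : Type*) [AddCommGroup X] [Module ℂ X] : Module ℂ (Renormed X) :=
  inferInstanceAs (Module ℂ X)

/-- A sesquilinear form on a Banach space which is equivalent to the square of the norm is the inner
product of a Hilbert space. -/
theorem exists_hilbert_renorming.{w} {X : Type w} [NormedAddCommGroup X] [NormedSpace ℂ X]
    [CompleteSpace X] {B : X → X → ℂ} {C : ℝ} (hC : 0 < C) (hconj : ∀ x y, conj (B x y) = B y x)
    (hpos : ∀ x, 0 ≤ (B x x).re) (hadd : ∀ x y z, B x (y + z) = B x y + B x z)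
    (hsmul : ∀ (c : ℂ) (x y : X), B x (c • y) = c * B x y)
    (hle : ∀ x, (B x x).re ≤ C * ‖x‖ ^ 2) (hge : ∀ x, ‖x‖ ^ 2 ≤ C * (B x x).re) :
    ∃ (E : Type w) (_ : NormedAddCommGroup E) (_ : InnerProductSpace ℂ E) (_ : CompleteSpace E)
      (φ : X ≃ₗ[ℂ] E), ∀ x y, inner ℂ (φ x) (φ y) = B x y := by
  have hadd' : ∀ x y z, B (x + y) z = B x z + B y z := fun x y z => by
    rw [← hconj, hadd, map_add, hconj, hconj]
  have hsmul' : ∀ (x y : X) (c : ℂ), B (c • x) y = conj c * B x y := fun x y c => by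
    rw [← hconj, hsmul, map_mul, hconj]
  let core : InnerProductSpace.Core ℂ (Renormed X) :=
    { inner := fun x y => B x y
      conj_inner_symm := fun x y => hconj y x
      re_inner_nonneg := hpos
      add_left := hadd'
      smul_left := hsmul'
      definite := fun x hx => by
        have h := hge x
        have hx' : B x x = 0 := hx
        rw [hx', Complex.zero_re, mul_zero] at h
        exact norm_eq_zero.1 (pow_eq_zero_iff two_ne_zero |>.1 (le_antisymm h (sq_nonneg _))) }
  let i1 : NormedAddCommGroup (Renormed X) := core.toNormedAddCommGroup
  let i2 : InnerProductSpace ℂ (Renormed X) := InnerProductSpace.ofCore core.toCore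
  let φ : X ≃ₗ[ℂ] Renormed X := LinearEquiv.refl ℂ X
  have hin : ∀ x y, inner ℂ (φ x) (φ y) = B x y := fun _ _ => rfl
  have hnorm : ∀ x, ‖φ x‖ ^ 2 = (B x x).re := fun x => by
    rw [← hin]
    exact norm_sq_eq_re_inner (𝕜 := ℂ) (φ x)
  have h1 : ∀ x, ‖φ x‖ ≤ √C * ‖x‖ := fun x => by
    refine abs_le_of_sq_le_sq' ?_ (by positivity) |>.2
    rw [hnorm, mul_pow, Real.sq_sqrt hC.le]
    exact hle x
  have h2 : ∀ y, ‖φ.symm y‖ ≤ √C * ‖y‖ := fun y => by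
    obtain ⟨x, rfl⟩ := φ.surjective y
    rw [φ.symm_apply_apply]
    refine abs_le_of_sq_le_sq' ?_ (by positivity) |>.2
    rw [mul_pow, hnorm, Real.sq_sqrt hC.le]
    exact hge x
  let e : X ≃L[ℂ] Renormed X := φ.toContinuousLinearEquivOfBounds (√C) (√C) h1 h2
  have hcomplete : CompleteSpace (Renormed X) :=
    (completeSpace_congr (e := e.toEquiv) e.isUniformEmbedding).1 inferInstance
  exact ⟨Renormed X, i1, i2, hcomplete, φ, hin⟩

/-! ### Identification with operator Hilbert spaces -/

theorem kerNorm_le_sq_iff_gramNorm_le {ι E : Type*} [Fintype ι] [DecidableEq ι]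
    [NormedAddCommGroup E] [InnerProductSpace ℂ E] (x : Matrix ι ι E) {C ν : ℝ} (hC : 0 ≤ C)
    (hν : 0 ≤ ν) : kerNorm (gram x) ≤ C * ν ^ 2 ↔ gramNorm x ≤ √C * ν := by
  rw [gramNorm, Real.sqrt_le_left (by positivity), mul_pow, Real.sq_sqrt hC]

theorem completelyIsomorphic_of_hilbertBasis {H I E : Type*} [NormedAddCommGroup H]
    [InnerProductSpace ℂ H] {X : Submodule ℂ (H →L[ℂ] H)} [NormedAddCommGroup E]
    [InnerProductSpace ℂ E] (b : HilbertBasis I ℂ E) (φ : X ≃ₗ[ℂ] E) {B : X → X → ℂ} {C : ℝ}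
    (hC : 0 < C) (hφ : ∀ x y, inner ℂ (φ x) (φ y) = B x y)
    (hB : ∀ (ι : Type) [Fintype ι] [DecidableEq ι] (x : Matrix ι ι X),
        kerNorm (formGram B x) ≤ C * opNorm' x ^ 2 ∧ opNorm' x ^ 2 ≤ C * kerNorm (formGram B x)) :
    CompletelyIsomorphic X (OH I) := by
  let ψ : E ≃ₗ[ℂ] OH I := b.repr.toLinearEquiv
  have hψ : ∀ x y, inner ℂ (ψ x) (ψ y) = inner ℂ x y := fun x y => b.repr.inner_map_map x y
  have hgram : ∀ (n : ℕ) (x : Matrix (Fin n) (Fin n) X),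
      formGram B x = gram (x.map (φ.trans ψ)) := by
    intro n x
    ext p q
    simp only [formGram, gram, Matrix.of_apply, Matrix.map_apply, LinearEquiv.trans_apply, hψ, hφ]
  refine ⟨φ.trans ψ, ⟨√C, fun n x => ?_⟩, ⟨√C, fun n y => ?_⟩⟩
  · have h := (hB (Fin n) x).1
    rw [hgram, kerNorm_le_sq_iff_gramNorm_le _ hC.le (opNorm'_nonneg x)] at h
    exact h
  · have h := (hB (Fin n) (y.map (φ.trans ψ).symm)).2
    rw [hgram] at h
    have e : (y.map (φ.trans ψ).symm).map (φ.trans ψ) = y := by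
      ext1 i j
      exact (φ.trans ψ).apply_symm_apply _
    rw [e, ← gramNorm_sq, ← Real.sq_sqrt hC.le, ← mul_pow] at h
    exact abs_le_of_sq_le_sq' h (mul_nonneg (Real.sqrt_nonneg _) (gramNorm_nonneg y)) |>.2

theorem exists_hilbert_coordinates.{w, t} {H : Type w} {J : Type t} [NormedAddCommGroup H] [InnerProductSpace ℂ H]
    [CompleteSpace H] {X : Submodule ℂ (H →L[ℂ] H)} (hX : IsClosed (X : Set (H →L[ℂ] H)))
    {F : ℕ → X → OH J}
    (hup : ∀ r, 0 < r → ∃ s, 0 < s ∧ AmplifiedUpperBound (fun _ _ x => opNorm' x) F r s)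
    (hlow : ∃ r, 0 < r ∧ AmplifiedLowerBound (fun _ _ x => opNorm' x) F r 1) :
    ∃ (B : X → X → ℂ) (C : ℝ) (E : Type w) (_ : NormedAddCommGroup E) (_ : InnerProductSpace ℂ E)
      (_ : CompleteSpace E) (φ : X ≃ₗ[ℂ] E), 0 < C ∧ (∀ x y, inner ℂ (φ x) (φ y) = B x y) ∧
      (∀ x, (B x x).re ≤ C * ‖x‖ ^ 2) ∧ (∀ x, ‖x‖ ^ 2 ≤ C * (B x x).re) ∧
      (∀ (ι : Type) [Fintype ι] [DecidableEq ι] (x : Matrix ι ι X),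
        kerNorm (formGram B x) ≤ C * opNorm' x ^ 2 ∧
          opNorm' x ^ 2 ≤ C * kerNorm (formGram B x)) := by
  have : CompleteSpace X := hX.completeSpace_coe
  obtain ⟨B, C, hC, hconj, hpos, hadd, hsmul, hB⟩ := exists_form (isMatrixNorm_opNorm' X) hup hlow
  have hunit : ∀ x : X, kerNorm (formGram B (Matrix.of fun _ _ : Unit => x)) = (B x x).re := by
    intro x
    have him : (B x x).im = 0 := Complex.conj_eq_iff_im.1 (hconj x x)
    have hn : ‖B x x‖ = (B x x).re := by
      rw [← Complex.re_add_im (B x x), him, Complex.ofReal_zero, zero_mul, add_zero,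
        Complex.norm_real, Real.norm_of_nonneg (hpos x), Complex.ofReal_re]
    rw [← hn]
    have hform : ∀ C : ℝ, 0 ≤ C →
        (kerNorm (formGram B (Matrix.of fun _ _ : Unit => x)) ≤ C ↔ ‖B x x‖ ≤ C) := by
      intro C hC
      rw [kerNorm_le_iff _ hC]
      constructor
      · intro h
        have := h fun _ => 1
        simp [formGram] at this
        exact abs_le_of_sq_le_sq' this hC |>.2
      · intro h v
        simp only [formGram, Matrix.of_apply, Fintype.sum_prod_type, Finset.univ_unique,
          Finset.sum_singleton, AddMonoidHom.coe_mulLeft, norm_mul, mul_pow]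
        gcongr
    exact eq_of_forall_le_iff_of_nonneg (kerNorm_nonneg _) (norm_nonneg _) hform
  have hbd : ∀ x : X, (B x x).re ≤ C * ‖x‖ ^ 2 ∧ ‖x‖ ^ 2 ≤ C * (B x x).re := by
    intro x
    have h := hB Unit (Matrix.of fun _ _ : Unit => x)
    rw [hunit] at h
    have hu := (isMatrixNorm_opNorm' X).unit x
    exact ⟨h.1.trans_eq (by rw [← hu]), le_trans (by rw [← hu]) h.2⟩
  obtain ⟨E, i1, i2, i3, φ, hφ⟩ := exists_hilbert_renorming hC hconj hpos hadd hsmul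
    (fun x => (hbd x).1) (fun x => (hbd x).2)
  exact ⟨B, C, E, i1, i2, i3, φ, hC, hφ, fun x => (hbd x).1, fun x => (hbd x).2, hB⟩

/-! ### Separability -/

theorem separableSpace_of_hilbertBasis {I E : Type*} [Countable I] [NormedAddCommGroup E]
    [InnerProductSpace ℂ E] (b : HilbertBasis I ℂ E) : TopologicalSpace.SeparableSpace E := by
  have h := ((Set.countable_range b).isSeparable.span (R := ℂ)).closure
  rw [← Submodule.topologicalClosure_coe, b.dense_span, Submodule.top_coe] at h
  exact TopologicalSpace.isSeparable_univ_iff.1 h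

instance (J : Type*) [Countable J] : TopologicalSpace.SeparableSpace (OH J) :=
  separableSpace_of_hilbertBasis
    (HilbertBasis.ofRepr (LinearIsometryEquiv.refl ℂ (lp (fun _ : J => ℂ) 2)))

theorem countable_of_one_le_dist {α Y : Type*} [PseudoMetricSpace Y]
    [TopologicalSpace.SeparableSpace Y] (g : α → Y) (hg : ∀ a b, a ≠ b → 1 ≤ dist (g a) (g b)) :
    Countable α := by
  refine Pairwise.countable_of_isOpen_disjoint (s := fun a => Metric.ball (g a) (1 / 2))
    (fun a b hab => ?_) (fun a => Metric.isOpen_ball) (fun a => ⟨g a, Metric.mem_ball_self (by norm_num)⟩)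
  refine Metric.ball_disjoint_ball ?_
  have := hg a b hab
  linarith

theorem countable_of_amplifiedLowerBound {X E Y I : Type*} [NormedAddCommGroup X] [NormedSpace ℂ X]
    [NormedAddCommGroup E] [InnerProductSpace ℂ E] [NormedAddCommGroup Y] [InnerProductSpace ℂ Y]
    [TopologicalSpace.SeparableSpace Y] {ν : ∀ (ι : Type) [Fintype ι], Matrix ι ι X → ℝ}
    (hν : IsMatrixNorm ν) {F : ℕ → X → Y} {r : ℝ} (hr : 0 < r) (h : AmplifiedLowerBound ν F r 1)
    (φ : X ≃ₗ[ℂ] E) {C : ℝ} (hC : 0 < C) (hle : ∀ x, ‖φ x‖ ^ 2 ≤ C * ‖x‖ ^ 2)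
    (hge : ∀ x, ‖x‖ ^ 2 ≤ C * ‖φ x‖ ^ 2) {b : I → E} (hb : Orthonormal ℂ b) : Countable I := by
  set t : ℝ := r * √C with ht
  have ht2 : t ^ 2 = r ^ 2 * C := by rw [ht, mul_pow, Real.sq_sqrt hC.le]
  have hnorm : ∀ v : E, ‖(t : ℂ) • v‖ ^ 2 = r ^ 2 * C * ‖v‖ ^ 2 := fun v => by
    rw [norm_smul, mul_pow, Complex.norm_real, Real.norm_eq_abs, sq_abs, ht2]
  set p : I → X := fun i => φ.symm ((t : ℂ) • b i) with hp
  obtain ⟨n, hn⟩ := exists_nat_ge (max 1 (r * C))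
  simp only [max_le_iff] at hn
  have hn1 : 1 ≤ n := by exact_mod_cast hn.1
  have hpn : ∀ i, ‖p i‖ ≤ n := by
    intro i
    refine le_trans (abs_le_of_sq_le_sq' ?_ (by positivity : 0 ≤ r * C) |>.2) hn.2
    refine (hge (p i)).trans_eq ?_
    rw [hp, φ.apply_symm_apply, hnorm, hb.1 i]
    ring
  refine countable_of_one_le_dist (fun i => F n (p i)) fun i j hij => ?_
  rw [dist_eq_norm]
  refine h.le_norm_image_sub hν hn1 (hpn i) (hpn j) ?_
  refine abs_le_of_sq_le_sq' ?_ (norm_nonneg _) |>.2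
  have h1 := hle (p i - p j)
  have h2 : φ (p i - p j) = (t : ℂ) • (b i - b j) := by
    rw [hp, map_sub, φ.apply_symm_apply, φ.apply_symm_apply, smul_sub]
  have h3 : ‖b i - b j‖ ^ 2 = 2 := by
    rw [@norm_sub_sq ℂ, hb.1 i, hb.1 j, hb.2 hij]
    norm_num
  rw [h2, hnorm, h3] at h1
  refine le_of_mul_le_mul_left ?_ hC
  nlinarith [mul_pos (pow_pos hr 2) hC]

end OpSpace
end


theorem mainTheorem2 {H : Type u} [NormedAddCommGroup H] [InnerProductSpace ℂ H]
    [CompleteSpace H] (X : Submodule ℂ (H →L[ℂ] H)) (hX : IsClosed (X : Set (H →L[ℂ] H))) :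
    (∀ J : Type v, OpSpace.BoundedSubsetsAlmostCompletelyCoarselyEmbed X (OpSpace.OH J) →
      ∃ I : Type u, OpSpace.CompletelyIsomorphic X (OpSpace.OH I)) ∧
    (¬ FiniteDimensional ℂ X →
      OpSpace.BoundedSubsetsAlmostCompletelyCoarselyEmbed X (OpSpace.OH ℕ) →
      OpSpace.CompletelyIsomorphic X (OpSpace.OH ℕ)) := by
  constructor
  · intro J h
    obtain ⟨F, hup, hlow⟩ := h.exists_amplified_bounds
    obtain ⟨B, C, E, _, _, _, φ, hC, hφ, -, -, hB⟩ :=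
      OpSpace.exists_hilbert_coordinates hX hup (hlow 1 one_pos)
    obtain ⟨w, b, -⟩ := exists_hilbertBasis ℂ E
    exact ⟨w, OpSpace.completelyIsomorphic_of_hilbertBasis b φ hC hφ hB⟩
  · intro hfin h
    obtain ⟨F, hup, hlow⟩ := h.exists_amplified_bounds
    obtain ⟨B, C, E, _, _, _, φ, hC, hφ, hle, hge, hB⟩ :=
      OpSpace.exists_hilbert_coordinates hX hup (hlow 1 one_pos)
    obtain ⟨w, b, -⟩ := exists_hilbertBasis ℂ E
    have hnorm : ∀ x, ‖φ x‖ ^ 2 = (B x x).re := fun x => by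
      rw [← hφ]
      exact norm_sq_eq_re_inner (𝕜 := ℂ) (φ x)
    obtain ⟨r, hr, hlow⟩ := hlow 1 one_pos
    have hcount : Countable w := OpSpace.countable_of_amplifiedLowerBound
      (OpSpace.isMatrixNorm_opNorm' X) hr hlow φ hC (fun x => (hnorm x).trans_le (hle x))
      (fun x => (hge x).trans_eq (by rw [hnorm])) b.orthonormal
    have hinf : Infinite w := by
      refine not_finite_iff_infinite.1 fun hw => hfin ?_
      have := Fintype.ofFinite w
      have : FiniteDimensional ℂ E := b.toOrthonormalBasis.toBasis.finiteDimensional_of_finite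
      exact φ.symm.finiteDimensional
    obtain ⟨e⟩ : Nonempty (w ≃ ℕ) := nonempty_equiv_of_countable
    have hdense : ⊤ ≤ (Submodule.span ℂ (Set.range (b ∘ e.symm))).topologicalClosure := by
      rw [e.symm.surjective.range_comp, b.dense_span]
    exact OpSpace.completelyIsomorphic_of_hilbertBasis
      (HilbertBasis.mk (b.orthonormal.comp e.symm e.symm.injective) hdense) φ hC hφ hB
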